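/- **System.** $N\ge 1$ robotic agents rigidly grasp an object among $Z$ obstacles $\mathcal O_z\subset\mathbb R^3$. Agent $i$ has joint coordinates $q_i\in\mathbb R^{n_i}$, smooth forward kinematics (end-effector position $p_{E_i}(q_i)$ and rotation matrix $R_i(q_i)\in SO(3)$), geometric Jacobian $J_i(q_i)\in\mathbb R^{6\times n_i}$, symmetric positive definite $C^2$ inertia matrix $B_i(q_i)$ with Coriolis matrix $C_{q_i}(q_i,\dot q_i)$ given by the Christoffel symbols of $B_i$, $C^1$ gravity term $g_{q_i}(q_i)$, constant grasp offset $p_i\in\mathbb R^3$, occupied volume $\mathcal A_i(q_i)\subset\mathbb R^3$, and limits $\bar\tau_i,\bar{\dot q}_i>0$. Put $\mathsf S_i=\{q_i:\det(J_iJ_i^\top)>0\}$, $J_i^+=J_i^\top(J_iJ_i^\top)^{-1}$, $M_i=(J_iB_i^{-1}J_i^\top)^{-1}$, $C_i=M_i(J_iB_i^{-1}C_{q_i}-\dot J_i)J_i^+$, $g_i=M_iJ_iB_i^{-1}g_{q_i}$, $J_{O_i}=\begin{bmatrix}I_3&-S(R_ip_i)\\0&I_3\end{bmatrix}$ with $S(a)b=a\times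 b$. The object has pose $x_O=(p_O,\eta_O)$ with Euler angles $\eta_O=(\phi,\theta,\psi)$, twist $v_O=(\dot p_O,\omega_O)$, $C^1$ symmetric positive definite inertia matrix $M_O(\eta_O)$, $C^1$ Coriolis matrix $C_O(\eta_O,\omega_O)$, gravity vector $g_O\in\mathbb R^6$, occupied volume $\mathcal A_O(x_O)\subset\mathbb R^3$, and representation Jacobian $$J_O=\mathrm{diag}\left(I_3,\begin{bmatrix}1&\sin\phi\tan\theta&\cos\phi\tan\theta\\0&\cos\phi&-\sin\phi\\0&\sin\phi/\cos\theta&\cos\phi/\cos\theta\end{bmatrix}\right).$$ With $G=[J_{O_1}^\top,\dots,J_{O_N}^\top]$, $M=\mathrm{diag}(M_i)$, $C=\mathrm{diag}(C_i)$, $g=(g_i)_i$, $q=(q_1,\dots,q_N)$, $n=\sum_i n_i$, state $x=(x_O,v_O,q)\in\mathbb R^{12+n}$ and input $u=(u_1,\dots,u_N)\in\mathbb R^{6N}$, the dynamics $\dot x=f_c(x,u)$ are $$\dot x_O=J_Ov_O,\qquad (M_O+GMG^\top)\dot v_O=Gu-(C_O+GCG^\top+GM\dot G^\top)v_O-(g_O+Gg),\qquad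 \dot q_i=J_i^+J_{O_i}v_O .$$ **Constraints.** Let $0\le\bar\theta<\pi/2$. $X_c$ is the set of states with $\theta\in[-\bar\theta,\bar\theta]$, $\|J_i^+J_{O_i}v_O\|\le\bar{\dot q}_i$ and $q_i\in\mathsf S_i$ for all $i$, and no collision: $\mathcal A_i(q_i)\cap\mathcal O_z=\emptyset$, $\mathcal A_O(x_O)\cap\mathcal O_z=\emptyset$, and $\mathcal A_i(q_i)\cap\mathcal A_j(q_j)=\emptyset$ for $i\ne j$. The torque constraints are imposed as $u\in U_c(x)$, i.e. $\|u_i\|\le\bar\tau_i/\sigma_{\min}(J_i(q_i)^\top)$ for all $i$. Fix a target $x_{\mathrm d}=(x_{O,\mathrm d},0,q_{\mathrm d})$, the error $e=x-x_{\mathrm d}$, $f_e(e,u)=f_c(e+x_{\mathrm d},u)$ and $E_c=X_c-x_{\mathrm d}$; below, $u\in U_c$ at error $e$ means $u\in U_c(e+x_{\mathrm d})$. **Controller.** Let $0<h_s<T_p$, $t_j=jh_s$, $F_c(e,u)=e^\top Q_ce+u^\top R_cu$, $V_c(e)=e^\top P_ce$, where $P_c,R_c$ are diagonal positive definite and $Q_c$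 is diagonal positive semidefinite with strictly positive entries on the pose and joint errors (the entries on $v_O$ may vanish). Let $\mathcal E_{c_f}$ be a terminal set. The optimal control problem (OCP) at $e_0$ minimizes $V_c(\hat e(T_p))+\int_0^{T_p}F_c(\hat e,\hat u)\,ds$ over piecewise continuous $\hat u$ and continuous $\hat e$ with $\dot{\hat e}=f_e(\hat e,\hat u)$ off a finite set, $\hat e(0)=e_0$, $\hat e(s)\in E_c$ and $\hat u(s)\in U_c$ for all $s\in[0,T_p]$, and $\hat e(T_p)\in\mathcal E_{c_f}$. It is feasible at $e_0$ if some $(\hat u,\hat e)$ satisfies these constraints. A closed-loop trajectory $(e,u)$ from $e_0$ satisfies $e(0)=e_0$, solves $\dot e=f_e(e,u)$ on every $[t_j,t_{j+1}]$, and, whenever the OCP is feasible at $e(t_j)$, $u(t_j+s)=\hat u^\star(s)$ for $s\in[0,h_s)$ with $\hat u^\star$ an optimal input of the OCP at $e(t_j)$. **Theorem.** Assume that the set of collision-free $(q,x_O)$ is connected and that: 1. the OCP is feasible at the initial error $e_0$; 2. $\mathcal E_{c_f}\subseteq E_c$ is closed and $0\in\mathcal E_{c_f}$; 3. for every $\bar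 e\in\mathcal E_{c_f}$ there are a piecewise continuous $u_{c_f}$ on $[0,h_s]$ and a solution $e$ of $\dot e=f_e(e,u_{c_f})$ with $e(0)=\bar e$ such that, for all $s\in[0,h_s]$, $u_{c_f}(s)\in U_c$, $e(s)\in\mathcal E_{c_f}$ and $\frac{\partial V_c}{\partial e}f_e(e(s),u_{c_f}(s))+F_c(e(s),u_{c_f}(s))\le0$. Then every closed-loop trajectory $(e,u)$ from $e_0$ satisfies $\lim_{t\to\infty}e(t)=0$; moreover $e(t)\in E_c$ and $u(t)\in U_c$ for all $t\ge0$, and the OCP is feasible at every $e(t_j)$. -/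

import Mathlib

open Set Filter Topology
open scoped Matrix ContDiff

noncomputable section

namespace CoopNMPC

/-! ### Index types and elementary operations -/

/-- Index set of `ℝ⁶ = ℝ³ × ℝ³`: poses `(p, η)`, twists `(ṗ, ω)` and wrenches. -/
abbrev Six := Fin 3 ⊕ Fin 3

/-- Joint coordinates of an agent with `m` joints. -/
abbrev Cfg (m : ℕ) := Fin m → ℝ

/-- Index set of `ℝ^(12 + n)`, `n = n₁ + ⋯ + n_N`: object pose, object twist, all joints. -/
abbrev StateIdx {N : ℕ} (n : Fin N → ℕ) := Six ⊕ (Six ⊕ (Σ i : Fin N, Fin (n i)))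

abbrev State {N : ℕ} (n : Fin N → ℕ) := StateIdx n → ℝ

/-- Index set of `ℝ^(6N)`; the entry `(s, i)` is the component `s` of the wrench of agent `i`. -/
abbrev InputIdx (N : ℕ) := Six × Fin N

abbrev Input (N : ℕ) := InputIdx N → ℝ

/-- Euclidean norm of a coordinate vector. -/
def l2norm {ι : Type*} [Fintype ι] (v : ι → ℝ) : ℝ := ‖WithLp.toLp 2 v‖

/-- The skew-symmetric matrix with `skew a *ᵥ b = a × b`. -/
def skew (a : Fin 3 → ℝ) : Matrix (Fin 3) (Fin 3) ℝ :=
  !![0, -a 2, a 1; a 2, 0, -a 0; -a 1, a 0, 0]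

/-- Inverse of `skew` on skew-symmetric matrices. -/
def vee (A : Matrix (Fin 3) (Fin 3) ℝ) : Fin 3 → ℝ := ![A 2 1, A 0 2, A 1 0]

/-- Entrywise directional derivative of a matrix-valued function at `q` in the direction `w`; this
is the time derivative of `A (q t)` when `q̇ = w`. -/
def dirDeriv {m : ℕ} {ι κ : Type*} (A : Cfg m → Matrix ι κ ℝ) (q w : Cfg m) : Matrix ι κ ℝ :=
  Matrix.of fun r c => fderiv ℝ (fun q' => A q' r c) q w

/-- Smallest singular value `min {‖A x‖ : ‖x‖ = 1}` (Euclidean norms) of a matrix with at least as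
many rows as columns. -/
def sigmaMin {ι κ : Type*} [Fintype ι] [Fintype κ] (A : Matrix ι κ ℝ) : ℝ :=
  sInf {r : ℝ | ∃ x : κ → ℝ, l2norm x = 1 ∧ r = l2norm (A *ᵥ x)}

/-! ### A robotic agent -/

/-- A robotic agent with `m` joints: forward kinematics, joint-space dynamics, grasp offset,
occupied volume, torque and joint-velocity limits. -/
structure Agent (m : ℕ) where
  /-- end-effector position -/
  pE : Cfg m → Fin 3 → ℝ
  pE_smooth : ContDiff ℝ ∞ pE
  /-- end-effector rotation matrix -/
  rot : Cfg m → Matrix (Fin 3) (Fin 3) ℝ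
  rot_smooth : ∀ a b, ContDiff ℝ ∞ fun q => rot q a b
  rot_mem : ∀ q, rot q ∈ Matrix.specialOrthogonalGroup (Fin 3) ℝ
  /-- joint-space inertia matrix -/
  inertia : Cfg m → Matrix (Fin m) (Fin m) ℝ
  inertia_smooth : ∀ a b, ContDiff ℝ 2 fun q => inertia q a b
  inertia_posDef : ∀ q, (inertia q).PosDef
  /-- joint-space gravity term -/
  gravity : Cfg m → Cfg m
  gravity_smooth : ContDiff ℝ 1 gravity
  /-- constant offset from the object's center of mass to the end effector, in the end-effector
  frame -/
  offset : Fin 3 → ℝ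
  /-- volume occupied by the agent -/
  vol : Cfg m → Set (Fin 3 → ℝ)
  torqueBound : ℝ
  torqueBound_pos : 0 < torqueBound
  velBound : ℝ
  velBound_pos : 0 < velBound

namespace Agent

variable {m : ℕ} (A : Agent m)

/-- Geometric Jacobian: `(ṗ_E, ω_E) = J(q) q̇`, where `Ṙ Rᵀ = skew ω_E`. -/
def jac (q : Cfg m) : Matrix Six (Fin m) ℝ :=
  Matrix.of fun r k =>
    match r with
    | Sum.inl a => fderiv ℝ (fun q' => A.pE q' a) q (Pi.single k 1)
    | Sum.inr a => vee (dirDeriv A.rot q (Pi.single k 1) * (A.rot q)ᵀ) a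

/-- Singularity-free configurations. -/
def nonsing : Set (Cfg m) := {q | 0 < (A.jac q * (A.jac q)ᵀ).det}

/-- Right pseudo-inverse `Jᵀ (J Jᵀ)⁻¹` of the Jacobian. -/
def pinv (q : Cfg m) : Matrix (Fin m) Six ℝ := (A.jac q)ᵀ * (A.jac q * (A.jac q)ᵀ)⁻¹

/-- Joint-space Coriolis matrix `C_q(q, q̇)` (Christoffel symbols of the inertia matrix). -/
def coriolis (q w : Cfg m) : Matrix (Fin m) (Fin m) ℝ :=
  Matrix.of fun j k => ∑ l, (1 / 2 : ℝ) *
    (fderiv ℝ (fun q' => A.inertia q' j k) q (Pi.single l 1)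
      + fderiv ℝ (fun q' => A.inertia q' j l) q (Pi.single k 1)
      - fderiv ℝ (fun q' => A.inertia q' k l) q (Pi.single j 1)) * w l

/-- Task-space inertia `M = (J B⁻¹ Jᵀ)⁻¹`. -/
def taskInertia (q : Cfg m) : Matrix Six Six ℝ :=
  (A.jac q * (A.inertia q)⁻¹ * (A.jac q)ᵀ)⁻¹

/-- Task-space Coriolis matrix: `C v = M (J B⁻¹ C_q - J̇) q̇` for the joint velocity
`q̇ = Jᵀ (J Jᵀ)⁻¹ v`. -/
def taskCoriolis (q w : Cfg m) : Matrix Six Six ℝ :=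
  A.taskInertia q * (A.jac q * (A.inertia q)⁻¹ * A.coriolis q w - dirDeriv A.jac q w) * A.pinv q

/-- Task-space gravity `g = M J B⁻¹ g_q`. -/
def taskGravity (q : Cfg m) : Six → ℝ :=
  (A.taskInertia q * A.jac q * (A.inertia q)⁻¹) *ᵥ A.gravity q

/-- Object-to-agent Jacobian: the end-effector twist is `objJac q *ᵥ v_O`. -/
def objJac (q : Cfg m) : Matrix Six Six ℝ :=
  Matrix.fromBlocks 1 (-skew (A.rot q *ᵥ A.offset)) 0 1

/-- Joint velocity `Jᵀ (J Jᵀ)⁻¹ J_{O_i} v_O` induced by the object twist. -/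
def jointVel (q : Cfg m) (v : Six → ℝ) : Cfg m := A.pinv q *ᵥ (A.objJac q *ᵥ v)

end Agent

/-! ### The coupled agents-object system -/

/-- Agents rigidly grasping an object in a workspace with `Z` obstacles. The object has inertia
matrix `M_O(η)`, Coriolis matrix `C_O(η, ω)` and gravity vector `g_O`; its pitch angle is
restricted to `[-θ̄, θ̄]`. -/
structure CoopSystem {N : ℕ} (n : Fin N → ℕ) (Z : ℕ) where
  agent : ∀ i, Agent (n i)
  objInertia : (Fin 3 → ℝ) → Matrix Six Six ℝ
  objInertia_smooth : ∀ a b, ContDiff ℝ 1 fun η => objInertia η a b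
  objInertia_posDef : ∀ η, (objInertia η).PosDef
  objCoriolis : (Fin 3 → ℝ) → (Fin 3 → ℝ) → Matrix Six Six ℝ
  objCoriolis_smooth : ∀ a b,
    ContDiff ℝ 1 fun p : (Fin 3 → ℝ) × (Fin 3 → ℝ) => objCoriolis p.1 p.2 a b
  objGravity : Six → ℝ
  /-- volume occupied by the object at a given pose -/
  objVol : (Six → ℝ) → Set (Fin 3 → ℝ)
  obstacle : Fin Z → Set (Fin 3 → ℝ)
  thetaBar : ℝ
  thetaBar_nonneg : 0 ≤ thetaBar
  thetaBar_lt : thetaBar < Real.pi / 2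

/-- Representation Jacobian `diag(I₃, J_η)` of the object: `ẋ_O = objRepJac η *ᵥ v_O`, for Euler
angles `η = (φ, θ, ψ)`. -/
def objRepJac (η : Fin 3 → ℝ) : Matrix Six Six ℝ :=
  Matrix.fromBlocks 1 0 0
    !![1, Real.sin (η 0) * Real.tan (η 1), Real.cos (η 0) * Real.tan (η 1);
       0, Real.cos (η 0), -Real.sin (η 0);
       0, Real.sin (η 0) / Real.cos (η 1), Real.cos (η 0) / Real.cos (η 1)]

variable {N : ℕ} {n : Fin N → ℕ} {Z : ℕ}

/-- Object pose `x_O = (p_O, η_O)`. -/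
def State.pose (x : State n) : Six → ℝ := fun k => x (Sum.inl k)

/-- Euler angles `η_O = (φ, θ, ψ)` of the object. -/
def State.euler (x : State n) : Fin 3 → ℝ := fun k => x (Sum.inl (Sum.inr k))

/-- Object twist `v_O = (ṗ_O, ω_O)`. -/
def State.twist (x : State n) : Six → ℝ := fun k => x (Sum.inr (Sum.inl k))

/-- Angular velocity `ω_O` of the object. -/
def State.omega (x : State n) : Fin 3 → ℝ := fun k => x (Sum.inr (Sum.inl (Sum.inr k)))

/-- Joint coordinates of agent `i`. -/
def State.joint (x : State n) (i : Fin N) : Cfg (n i) := fun k => x (Sum.inr (Sum.inr ⟨i, k⟩))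

/-- The state with given pose, twist and joint coordinates. -/
def State.mk (p v : Six → ℝ) (q : ∀ i, Cfg (n i)) : State n :=
  Sum.elim p (Sum.elim v fun a => q a.1 a.2)

/-- The wrench applied by agent `i`. -/
def Input.wrench (u : Input N) (i : Fin N) : Six → ℝ := fun s => u (s, i)

namespace CoopSystem

variable (S : CoopSystem n Z)

/-- Joint velocity of agent `i` in state `x`. -/
def qdot (x : State n) (i : Fin N) : Cfg (n i) :=
  (S.agent i).jointVel (State.joint x i) (State.twist x)

/-- Grasp matrix `G = [J_{O_1}ᵀ, …, J_{O_N}ᵀ]`. -/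
def grasp (x : State n) : Matrix Six (InputIdx N) ℝ :=
  Matrix.of fun r c => ((S.agent c.2).objJac (State.joint x c.2))ᵀ r c.1

/-- Time derivative of the grasp matrix along the motion. -/
def graspDot (x : State n) : Matrix Six (InputIdx N) ℝ :=
  Matrix.of fun r c =>
    (dirDeriv (S.agent c.2).objJac (State.joint x c.2) (S.qdot x c.2))ᵀ r c.1

/-- `M = diag(M_1, …, M_N)`. -/
def stackInertia (x : State n) : Matrix (InputIdx N) (InputIdx N) ℝ :=
  Matrix.blockDiagonal fun i => (S.agent i).taskInertia (State.joint x i)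

/-- `C = diag(C_1, …, C_N)`. -/
def stackCoriolis (x : State n) : Matrix (InputIdx N) (InputIdx N) ℝ :=
  Matrix.blockDiagonal fun i => (S.agent i).taskCoriolis (State.joint x i) (S.qdot x i)

/-- `g = (g_1, …, g_N)`. -/
def stackGravity (x : State n) : Input N :=
  fun c => (S.agent c.2).taskGravity (State.joint x c.2) c.1

/-- Coupled inertia `M_O + G M Gᵀ`. -/
def coupledInertia (x : State n) : Matrix Six Six ℝ :=
  S.objInertia (State.euler x) + S.grasp x * S.stackInertia x * (S.grasp x)ᵀ

/-- Coupled Coriolis matrix `C_O + G C Gᵀ + G M Ġᵀ`. -/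
def coupledCoriolis (x : State n) : Matrix Six Six ℝ :=
  S.objCoriolis (State.euler x) (State.omega x)
    + S.grasp x * S.stackCoriolis x * (S.grasp x)ᵀ
    + S.grasp x * S.stackInertia x * (S.graspDot x)ᵀ

/-- Coupled gravity vector `g_O + G g`. -/
def coupledGravity (x : State n) : Six → ℝ :=
  S.objGravity + S.grasp x *ᵥ S.stackGravity x

/-- The coupled dynamics `ẋ = f_c(x, u)`. -/
def dyn (x : State n) (u : Input N) : State n :=
  State.mk
    (objRepJac (State.euler x) *ᵥ State.twist x)
    ((S.coupledInertia x)⁻¹ *ᵥ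
      (S.grasp x *ᵥ u - S.coupledCoriolis x *ᵥ State.twist x - S.coupledGravity x))
    (S.qdot x)

/-- No agent meets an obstacle, no two agents meet, and the object meets no obstacle. -/
def CollisionFree (q : ∀ i, Cfg (n i)) (p : Six → ℝ) : Prop :=
  (∀ i z, (S.agent i).vol (q i) ∩ S.obstacle z = ∅) ∧
  (∀ i j, i ≠ j → (S.agent i).vol (q i) ∩ (S.agent j).vol (q j) = ∅) ∧
  (∀ z, S.objVol p ∩ S.obstacle z = ∅)

/-- The state constraint set `X_c`. -/
def stateSet : Set (State n) :=
  {x | State.euler x 1 ∈ Icc (-S.thetaBar) S.thetaBar ∧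
    (∀ i, l2norm (S.qdot x i) ≤ (S.agent i).velBound) ∧
    (∀ i, State.joint x i ∈ (S.agent i).nonsing) ∧
    S.CollisionFree (State.joint x) (State.pose x)}

/-- The input constraint set `U_c` at state `x`: `‖u_i‖ ≤ τ̄_i / σ_min(J_i(q_i)ᵀ)`. -/
def inputSet (x : State n) : Set (Input N) :=
  {u | ∀ i, l2norm (Input.wrench u i) ≤
    (S.agent i).torqueBound / sigmaMin ((S.agent i).jac (State.joint x i))ᵀ}

end CoopSystem

/-! ### Trajectories -/

/-- `u` is piecewise continuous on `[a, b]`: continuous off a finite set, with one-sided limits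
everywhere. -/
def PiecewiseContinuousOn {E : Type*} [TopologicalSpace E] (u : ℝ → E) (a b : ℝ) : Prop :=
  (∃ D : Set ℝ, D.Finite ∧ ∀ t ∈ Icc a b \ D, ContinuousWithinAt u (Icc a b) t) ∧
  (∀ t ∈ Ico a b, ∃ l, Tendsto u (𝓝[>] t) (𝓝 l)) ∧
  (∀ t ∈ Ioc a b, ∃ l, Tendsto u (𝓝[<] t) (𝓝 l))

/-- `e` is a solution of `ė = f(e, u)` on `[a, b]`: it is continuous, and differentiable with the
right derivative off a finite set. -/
def IsSolution {E U : Type*} [NormedAddCommGroup E] [NormedSpace ℝ E]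
    (f : E → U → E) (u : ℝ → U) (e : ℝ → E) (a b : ℝ) : Prop :=
  ContinuousOn e (Icc a b) ∧
  ∃ D : Set ℝ, D.Finite ∧ ∀ t ∈ Icc a b \ D, HasDerivWithinAt e (f (e t) (u t)) (Icc a b) t

/-! ### The predictive controller -/

/-- Target, horizon, sampling period, weights and terminal set of the controller. -/
structure MPCData {N : ℕ} (n : Fin N → ℕ) where
  /-- desired object pose -/
  poseDes : Six → ℝ
  /-- desired joint coordinates -/
  jointDes : ∀ i, Cfg (n i)
  /-- prediction horizon -/
  Tp : ℝ
  /-- sampling period -/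
  hs : ℝ
  Q : Matrix (StateIdx n) (StateIdx n) ℝ
  R : Matrix (InputIdx N) (InputIdx N) ℝ
  P : Matrix (StateIdx n) (StateIdx n) ℝ
  /-- terminal set, in error coordinates -/
  terminal : Set (State n)

namespace MPCData

variable (S : CoopSystem n Z) (D : MPCData n)

/-- The target state: desired pose, zero twist, desired joints. -/
def target : State n := State.mk D.poseDes 0 D.jointDes

/-- Error dynamics `f_e(e, u) = f_c(e + x_d, u)`. -/
def errDyn (e : State n) (u : Input N) : State n := S.dyn (e + D.target) u

/-- The state constraint set `E_c` in error coordinates. -/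
def errSet : Set (State n) := {e | e + D.target ∈ S.stateSet}

/-- The input constraint set at error `e`. -/
def errInputSet (e : State n) : Set (Input N) := S.inputSet (e + D.target)

/-- Running cost `eᵀ Q e + uᵀ R u`. -/
def runCost (e : State n) (u : Input N) : ℝ := e ⬝ᵥ (D.Q *ᵥ e) + u ⬝ᵥ (D.R *ᵥ u)

/-- Terminal cost `eᵀ P e`. -/
def termCost (e : State n) : ℝ := e ⬝ᵥ (D.P *ᵥ e)

/-- `u`, with predicted error trajectory `e`, satisfies all constraints of the optimal control
problem started at `e₀`. As nothing depends explicitly on time, the prediction window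
`[t_j, t_j + T_p]` is shifted to `[0, T_p]`. -/
structure IsFeasible (e₀ : State n) (u : ℝ → Input N) (e : ℝ → State n) : Prop where
  piecewise : PiecewiseContinuousOn u 0 D.Tp
  solution : IsSolution (D.errDyn S) u e 0 D.Tp
  initial : e 0 = e₀
  state_mem : ∀ s ∈ Icc 0 D.Tp, e s ∈ D.errSet S
  input_mem : ∀ s ∈ Icc 0 D.Tp, u s ∈ D.errInputSet S (e s)
  terminal_mem : e D.Tp ∈ D.terminal

/-- The optimal control problem started at `e₀` is feasible. -/
def Feasible (e₀ : State n) : Prop := ∃ u e, D.IsFeasible S e₀ u e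

/-- Cost of an input and its predicted error trajectory. -/
def cost (u : ℝ → Input N) (e : ℝ → State n) : ℝ :=
  D.termCost (e D.Tp) + ∫ s in (0 : ℝ)..D.Tp, D.runCost (e s) (u s)

/-- `u` is an optimal input for the optimal control problem started at `e₀`. -/
def IsOptimal (e₀ : State n) (u : ℝ → Input N) : Prop :=
  ∃ e, D.IsFeasible S e₀ u e ∧
    ∀ u' e', D.IsFeasible S e₀ u' e' → D.cost u e ≤ D.cost u' e'

/-- `(e, u)` is a closed-loop trajectory from `e₀` with sampling times `t_j = j h_s`: `e` solves
the error dynamics with input `u`, and at every sampling time at which the optimal control problem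
is feasible, an optimal input is computed from `e(t_j)` and applied on `[t_j, t_{j+1})`. -/
structure IsClosedLoop (e₀ : State n) (e : ℝ → State n) (u : ℝ → Input N) : Prop where
  initial : e 0 = e₀
  solution : ∀ j : ℕ, IsSolution (D.errDyn S) u e (j * D.hs) ((j + 1) * D.hs)
  law : ∀ j : ℕ, D.Feasible S (e (j * D.hs)) →
    ∃ ustar, D.IsOptimal S (e (j * D.hs)) ustar ∧
      ∀ s ∈ Ico 0 D.hs, u (j * D.hs + s) = ustar s

/-- From every point of the terminal set there is an admissible input on `[0, h_s]` that keeps the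
error in the terminal set and along which `(∂V/∂e) f_e + F ≤ 0`. -/
def TerminalCondition : Prop :=
  ∀ e₀ ∈ D.terminal, ∃ (u : ℝ → Input N) (e : ℝ → State n),
    PiecewiseContinuousOn u 0 D.hs ∧ IsSolution (D.errDyn S) u e 0 D.hs ∧ e 0 = e₀ ∧
    ∀ s ∈ Icc 0 D.hs,
      u s ∈ D.errInputSet S (e s) ∧ e s ∈ D.terminal ∧
      fderiv ℝ D.termCost (e s) (D.errDyn S (e s) (u s)) + D.runCost (e s) (u s) ≤ 0

end MPCData

end CoopNMPC

end

/-! The argument has two halves.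

Decrease of the optimal cost. A feasible prediction can be shifted by one sampling period and
continued with the terminal controller. The result is again feasible, and the terminal inequality,
once integrated, shows that its cost drops by at least the running cost spent during the period
(`IsFeasible.exists_shift`). The dynamics is `C¹` wherever the pitch is away from `±π/2` and the
arms are nonsingular, so solutions are unique and the closed loop coincides with the prediction
between samples (`IsClosedLoop.eqOn_prediction`). Hence feasibility propagates, the constraints
hold, and the optimal costs form a decreasing nonnegative sequence whose increments tend to zero.
Since `Q` is diagonal, these increments dominate the integrals of the squared pose and joint errors
over the sampling intervals (`IsClosedLoop.exists_integral_sq_le`).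

Convergence of the state (`tendsto_zero_of_integral`). The nonsingular set is open, so the
constraints alone give no uniform distance from singularities, and the twist may carry no weight in
the cost. The components are therefore treated in order: - the joint rates are bounded by
constraint, so the joint errors are Lipschitz and tend to zero; - the joints then stay near the
nonsingular target, which bounds the twist (recovered from the joint rates of one agent) and the
inputs; - the pose rates are now bounded, so the pose error tends to zero; - the error finally stays
in a compact set of regular states, so it is Lipschitz, the joint rates are uniformly continuous,
and Barbalat's lemma sends them, and with them the twist, to zero. -/

namespace CoopNMPC

/-! ### Calculus with finitely many exceptional points -/

/-- A transitive relation on subintervals of `[a, b]` that holds on the subintervals whose interior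
avoids a finite set holds on `[a, b]`. -/
theorem rel_of_finite_exceptions {D : Set ℝ} (hD : D.Finite) {P : ℝ → ℝ → Prop} {a b : ℝ}
    (hab : a ≤ b)
    (base : ∀ c d, a ≤ c → c ≤ d → d ≤ b → Disjoint (Ioo c d) D → P c d)
    (trans : ∀ c d e, a ≤ c → c ≤ d → d ≤ e → e ≤ b → P c d → P d e → P c e) : P a b := by
  induction D, hD using Set.Finite.induction_on with
  | empty => exact base a b le_rfl hab le_rfl (disjoint_empty _)
  | @insert z D' _ _ ih =>
    -- It remains to treat an interval whose interior avoids `D'`. If `z` is an interior point,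
    -- cutting there leaves two intervals whose interiors avoid `z` as well.
    refine ih fun c d hac hcd hdb hdis => ?_
    by_cases hz : z ∈ Ioo c d
    · refine trans c z d hac hz.1.le hz.2.le hdb (base c z hac hz.1.le (hz.2.le.trans hdb) ?_)
        (base z d (hac.trans hz.1.le) hz.2.le hdb ?_)
      · rw [disjoint_insert_right]
        exact ⟨fun h => lt_irrefl _ h.2, hdis.mono_left (Ioo_subset_Ioo_right hz.2.le)⟩
      · rw [disjoint_insert_right]
        exact ⟨fun h => lt_irrefl _ h.1, hdis.mono_left (Ioo_subset_Ioo_left hz.1.le)⟩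
    · exact base c d hac hcd hdb (disjoint_insert_right.2 ⟨hz, hdis⟩)

/-- Mean value inequality with finitely many exceptional points. -/
theorem sub_le_mul_of_hasDerivWithinAt {D : Set ℝ} (hD : D.Finite) {φ : ℝ → ℝ} {a b C : ℝ}
    (hab : a ≤ b) (hφ : ContinuousOn φ (Icc a b))
    (h : ∀ t ∈ Ioo a b \ D, ∃ d ≤ C, HasDerivWithinAt φ d (Icc a b) t) :
    φ b - φ a ≤ C * (b - a) := by
  refine rel_of_finite_exceptions hD (P := fun c d => φ d - φ c ≤ C * (d - c)) hab ?_ ?_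
  · intro c d hac hcd hdb hdis
    have key : ∀ t ∈ Ioo c d, ∃ d ≤ C, HasDerivAt φ d t := by
      intro t ht
      obtain ⟨y, hy, hd⟩ := h t ⟨⟨hac.trans_lt ht.1, ht.2.trans_le hdb⟩, disjoint_left.1 hdis ht⟩
      exact ⟨y, hy, hd.hasDerivAt (Icc_mem_nhds (hac.trans_lt ht.1) (ht.2.trans_le hdb))⟩
    refine (convex_Icc c d).image_sub_le_mul_sub_of_deriv_le
      (hφ.mono (Icc_subset_Icc hac hdb)) ?_ ?_ c (left_mem_Icc.2 hcd) d (right_mem_Icc.2 hcd) hcd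
    · rw [interior_Icc]
      intro t ht
      obtain ⟨y, -, hd⟩ := key t ht
      exact hd.differentiableAt.differentiableWithinAt
    · rw [interior_Icc]
      intro t ht
      obtain ⟨y, hy, hd⟩ := key t ht
      rwa [hd.deriv]
  · intro c d e _ _ _ _ h1 h2
    linarith

theorem abs_sub_le_mul_of_hasDerivWithinAt {D : Set ℝ} (hD : D.Finite) {φ : ℝ → ℝ} {a b C : ℝ}
    (hab : a ≤ b) (hφ : ContinuousOn φ (Icc a b))
    (h : ∀ t ∈ Ioo a b \ D, ∃ d, |d| ≤ C ∧ HasDerivWithinAt φ d (Icc a b) t) :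
    |φ b - φ a| ≤ C * (b - a) := by
  rw [abs_le]
  constructor
  · have := sub_le_mul_of_hasDerivWithinAt (φ := fun t => -φ t) (C := C) hD hab hφ.neg ?_
    · linarith
    · intro t ht
      obtain ⟨d, hd, hd'⟩ := h t ht
      exact ⟨-d, by linarith [(abs_le.1 hd).1], hd'.neg⟩
  · refine sub_le_mul_of_hasDerivWithinAt hD hab hφ fun t ht => ?_
    obtain ⟨d, hd, hd'⟩ := h t ht
    exact ⟨d, (abs_le.1 hd).2, hd'⟩

/-! ### Piecewise continuous functions -/

section Piecewise

variable {E F G : Type*} [TopologicalSpace E] [TopologicalSpace F] [TopologicalSpace G]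

theorem PiecewiseContinuousOn.mono {u : ℝ → E} {a b c d : ℝ} (h : PiecewiseContinuousOn u a b)
    (hac : a ≤ c) (hdb : d ≤ b) : PiecewiseContinuousOn u c d := by
  obtain ⟨⟨D, hD, hc⟩, hr, hl⟩ := h
  exact ⟨⟨D, hD, fun t ht => (hc t ⟨⟨hac.trans ht.1.1, ht.1.2.trans hdb⟩, ht.2⟩).mono
    (Icc_subset_Icc hac hdb)⟩, fun t ht => hr t ⟨hac.trans ht.1, ht.2.trans_le hdb⟩,
    fun t ht => hl t ⟨hac.trans_lt ht.1, ht.2.trans hdb⟩⟩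

theorem PiecewiseContinuousOn.comp_add_const {u : ℝ → E} {a b : ℝ} (c : ℝ)
    (h : PiecewiseContinuousOn u a b) :
    PiecewiseContinuousOn (fun s => u (s + c)) (a - c) (b - c) := by
  obtain ⟨⟨D, hD, hc⟩, hr, hl⟩ := h
  have hcont : ∀ t : ℝ, Tendsto (fun s => s + c) (𝓝 t) (𝓝 (t + c)) := fun t =>
    (continuous_id.add continuous_const).tendsto t
  refine ⟨⟨(fun s => s + c) ⁻¹' D, hD.preimage (add_left_injective c).injOn, fun t ht => ?_⟩,
    fun t ht => ?_, fun t ht => ?_⟩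
  · have := hc (t + c) ⟨⟨by linarith [ht.1.1], by linarith [ht.1.2]⟩, ht.2⟩
    refine ContinuousWithinAt.comp (t := Icc a b) this
      (continuous_id.add continuous_const).continuousWithinAt fun s hs => ?_
    exact ⟨by linarith [hs.1], by linarith [hs.2]⟩
  · obtain ⟨l, hl⟩ := hr (t + c) ⟨by linarith [ht.1], by linarith [ht.2]⟩
    refine ⟨l, hl.comp ?_⟩
    exact tendsto_nhdsWithin_of_tendsto_nhds_of_eventually_within _
      ((hcont t).mono_left nhdsWithin_le_nhds)
      (eventually_nhdsWithin_of_forall fun s (hs : t < s) => by simpa using hs)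
  · obtain ⟨l, hl⟩ := hl (t + c) ⟨by linarith [ht.1], by linarith [ht.2]⟩
    refine ⟨l, hl.comp ?_⟩
    exact tendsto_nhdsWithin_of_tendsto_nhds_of_eventually_within _
      ((hcont t).mono_left nhdsWithin_le_nhds)
      (eventually_nhdsWithin_of_forall fun s (hs : s < t) => by simpa using hs)

/-- The endpoints can be added to the exceptional set, and the one-sided limits only see interior
points. This makes endpoint values irrelevant when inputs are glued. -/
theorem PiecewiseContinuousOn.congr {u u' : ℝ → E} {a b : ℝ} (h : PiecewiseContinuousOn u a b)
    (hu : EqOn u' u (Ioo a b)) : PiecewiseContinuousOn u' a b := by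
  obtain ⟨⟨D, hD, hc⟩, hr, hl⟩ := h
  refine ⟨⟨D ∪ {a, b}, hD.union (by simp), fun t ht => ?_⟩, fun t ht => ?_, fun t ht => ?_⟩
  · simp only [mem_union, mem_insert_iff, mem_singleton_iff, not_or, Set.mem_sdiff] at ht
    have ht' : t ∈ Ioo a b :=
      ⟨lt_of_le_of_ne ht.1.1 (Ne.symm ht.2.2.1), lt_of_le_of_ne ht.1.2 ht.2.2.2⟩
    refine (hc t ⟨ht.1, ht.2.1⟩).congr_of_eventuallyEq ?_ (hu ht')
    exact mem_nhdsWithin_of_mem_nhds (mem_of_superset (Ioo_mem_nhds ht'.1 ht'.2) hu)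
  · obtain ⟨l, hl⟩ := hr t ht
    refine ⟨l, hl.congr' ?_⟩
    filter_upwards [Ioo_mem_nhdsGT ht.2] with s hs
    exact (hu ⟨ht.1.trans_lt hs.1, hs.2⟩).symm
  · obtain ⟨l, hl⟩ := hl t ht
    refine ⟨l, hl.congr' ?_⟩
    filter_upwards [Ioo_mem_nhdsLT ht.1] with s hs
    exact (hu ⟨hs.1, hs.2.trans_le ht.2⟩).symm

/-- The junction `b` becomes an exceptional point: the left limit comes from the first piece and the
right limit from the second, and they need not agree. -/
theorem PiecewiseContinuousOn.trans {u : ℝ → E} {a b c : ℝ}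
    (h₁ : PiecewiseContinuousOn u a b) (h₂ : PiecewiseContinuousOn u b c) :
    PiecewiseContinuousOn u a c := by
  obtain ⟨⟨D, hD, hc⟩, hr, hl⟩ := h₁
  obtain ⟨⟨D', hD', hc'⟩, hr', hl'⟩ := h₂
  refine ⟨⟨D ∪ D' ∪ {b}, (hD.union hD').union (finite_singleton b), fun t ht => ?_⟩,
    fun t ht => ?_, fun t ht => ?_⟩
  · simp only [mem_union, mem_singleton_iff, not_or, Set.mem_sdiff] at ht
    rcases lt_or_gt_of_ne ht.2.2 with hb | hb
    · refine (hc t ⟨⟨ht.1.1, hb.le⟩, ht.2.1.1⟩).mono_of_mem_nhdsWithin ?_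
      filter_upwards [self_mem_nhdsWithin, mem_nhdsWithin_of_mem_nhds (Iio_mem_nhds hb)]
        with s hs hs' using ⟨hs.1, le_of_lt hs'⟩
    · refine (hc' t ⟨⟨hb.le, ht.1.2⟩, ht.2.1.2⟩).mono_of_mem_nhdsWithin ?_
      filter_upwards [self_mem_nhdsWithin, mem_nhdsWithin_of_mem_nhds (Ioi_mem_nhds hb)]
        with s hs hs' using ⟨le_of_lt hs', hs.2⟩
  · rcases lt_or_ge t b with hb | hb
    · exact hr t ⟨ht.1, hb⟩
    · exact hr' t ⟨hb, ht.2⟩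
  · rcases le_or_gt t b with hb | hb
    · exact hl t ⟨ht.1, hb⟩
    · exact hl' t ⟨hb, ht.2⟩

theorem PiecewiseContinuousOn.comp₂ {u : ℝ → E} {e : ℝ → F} {a b : ℝ} {g : F → E → G}
    (hu : PiecewiseContinuousOn u a b) (he : ContinuousOn e (Icc a b))
    (hg : Continuous fun p : F × E => g p.1 p.2) :
    PiecewiseContinuousOn (fun t => g (e t) (u t)) a b := by
  obtain ⟨⟨D, hD, hc⟩, hr, hl⟩ := hu
  refine ⟨⟨D, hD, fun t ht => ?_⟩, fun t ht => ?_, fun t ht => ?_⟩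
  · exact hg.continuousAt.comp_continuousWithinAt
      (f := fun s => (e s, u s)) ((he t ht.1).prodMk (hc t ht))
  · obtain ⟨l, hl⟩ := hr t ht
    refine ⟨g (e t) l, (hg.tendsto (e t, l)).comp (Tendsto.prodMk_nhds ?_ hl)⟩
    exact (he t ⟨ht.1, ht.2.le⟩).mono_of_mem_nhdsWithin
      (mem_of_superset (Ioc_mem_nhdsGT ht.2) fun s hs => ⟨ht.1.trans hs.1.le, hs.2⟩)
  · obtain ⟨l, hl⟩ := hl t ht
    refine ⟨g (e t) l, (hg.tendsto (e t, l)).comp (Tendsto.prodMk_nhds ?_ hl)⟩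
    exact (he t ⟨ht.1.le, ht.2⟩).mono_of_mem_nhdsWithin
      (mem_of_superset (Ico_mem_nhdsLT ht.1) fun s hs => ⟨hs.1, hs.2.le.trans ht.2⟩)

end Piecewise

/-- Compactness reduces the claim to a neighbourhood of each point, where the two one-sided limits
and the value at the point itself give a bound. -/
theorem PiecewiseContinuousOn.bounded {φ : ℝ → ℝ} {a b : ℝ} (h : PiecewiseContinuousOn φ a b) :
    ∃ C, ∀ t ∈ Icc a b, ‖φ t‖ ≤ C := by
  obtain ⟨-, hr, hl⟩ := h
  refine isCompact_Icc.induction_on (p := fun s => ∃ C, ∀ t ∈ s, ‖φ t‖ ≤ C) ⟨0, by simp⟩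
    (fun s t hst ⟨C, hC⟩ => ⟨C, fun x hx => hC x (hst hx)⟩) ?_ ?_
  · rintro s t ⟨C, hC⟩ ⟨C', hC'⟩
    refine ⟨max C C', ?_⟩
    rintro x (hx | hx)
    · exact (hC x hx).trans (le_max_left _ _)
    · exact (hC' x hx).trans (le_max_right _ _)
  · intro t ht
    have hright : ∃ C, ∀ᶠ s in 𝓝[>] t, s ∈ Icc a b → ‖φ s‖ ≤ C := by
      rcases lt_or_ge t b with htb | htb
      · obtain ⟨l, hl⟩ := hr t ⟨ht.1, htb⟩
        exact ⟨‖l‖ + 1, (hl.norm.eventually_le_const (lt_add_one _)).mono fun s hs _ => hs⟩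
      · refine ⟨0, eventually_nhdsWithin_of_forall fun s (hs : t < s) hs' => ?_⟩
        exact absurd (hs.trans_le hs'.2) (not_lt.2 htb)
    have hleft : ∃ C, ∀ᶠ s in 𝓝[<] t, s ∈ Icc a b → ‖φ s‖ ≤ C := by
      rcases lt_or_ge a t with htb | htb
      · obtain ⟨l, hl⟩ := hl t ⟨htb, ht.2⟩
        exact ⟨‖l‖ + 1, (hl.norm.eventually_le_const (lt_add_one _)).mono fun s hs _ => hs⟩
      · refine ⟨0, eventually_nhdsWithin_of_forall fun s (hs : s < t) hs' => ?_⟩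
        exact absurd (hs'.1.trans_lt hs) (not_lt.2 htb)
    obtain ⟨C, hC⟩ := hright
    obtain ⟨C', hC'⟩ := hleft
    refine ⟨{s | s ∈ Icc a b ∧ ‖φ s‖ ≤ max (max C C') ‖φ t‖}, ?_, _, fun s hs => hs.2⟩
    rw [eventually_nhdsWithin_iff] at hC hC'
    filter_upwards [mem_nhdsWithin_of_mem_nhds hC, mem_nhdsWithin_of_mem_nhds hC',
      self_mem_nhdsWithin] with s h1 h2 h3
    refine ⟨h3, ?_⟩
    rcases lt_trichotomy s t with hs | hs | hs
    · exact (h2 hs h3).trans ((le_max_right _ _).trans (le_max_left _ _))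
    · rw [hs]; exact le_max_right _ _
    · exact (h1 hs h3).trans ((le_max_left _ _).trans (le_max_left _ _))

/-- Such a function is bounded, and it is measurable because it is continuous off a null set. -/
theorem PiecewiseContinuousOn.intervalIntegrable {φ : ℝ → ℝ} {a b : ℝ} (hab : a ≤ b)
    (h : PiecewiseContinuousOn φ a b) : IntervalIntegrable φ MeasureTheory.volume a b := by
  obtain ⟨C, hC⟩ := h.bounded
  obtain ⟨⟨D, hD, hc⟩, -, -⟩ := h
  rw [intervalIntegrable_iff_integrableOn_Icc_of_le hab]
  refine MeasureTheory.IntegrableOn.of_bound (by simp) ?_ C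
    ((MeasureTheory.ae_restrict_iff' measurableSet_Icc).2 (Eventually.of_forall hC))
  have h1 : ContinuousOn φ (Icc a b \ D) := fun t ht => (hc t ht).mono sdiff_subset
  have h2 := h1.aestronglyMeasurable (μ := MeasureTheory.volume)
    (measurableSet_Icc.diff hD.measurableSet)
  rwa [MeasureTheory.Measure.restrict_congr_set
    (MeasureTheory.sdiff_null_ae_eq_self (hD.measure_zero _))] at h2

/-! ### Solutions of controlled differential equations -/

section Solution

variable {E U : Type*} [NormedAddCommGroup E] [NormedSpace ℝ E] {f : E → U → E}
  {u u' : ℝ → U} {e e' : ℝ → E} {a b c d : ℝ}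

theorem IsSolution.mono (h : IsSolution f u e a b) (hac : a ≤ c) (hdb : d ≤ b) :
    IsSolution f u e c d := by
  obtain ⟨hc, D, hD, hd⟩ := h
  have hsub := Icc_subset_Icc hac hdb
  exact ⟨hc.mono hsub, D, hD, fun t ht => (hd t ⟨hsub ht.1, ht.2⟩).mono hsub⟩

theorem IsSolution.comp_add_const (h : IsSolution f u e a b) (c : ℝ) :
    IsSolution f (fun s => u (s + c)) (fun s => e (s + c)) (a - c) (b - c) := by
  obtain ⟨hc, D, hD, hd⟩ := h
  have hmaps : MapsTo (fun s => s + c) (Icc (a - c) (b - c)) (Icc a b) := fun s hs =>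
    ⟨by linarith [hs.1], by linarith [hs.2]⟩
  refine ⟨hc.comp (by fun_prop) hmaps, (fun s => s + c) ⁻¹' D,
    hD.preimage (add_left_injective c).injOn, fun t ht => ?_⟩
  have h1 := hd (t + c) ⟨hmaps ht.1, ht.2⟩
  have h2 := HasDerivWithinAt.scomp t h1
    ((hasDerivAt_id t).add_const c).hasDerivWithinAt hmaps
  simpa [Function.comp_def] using h2

theorem IsSolution.congr (h : IsSolution f u e a b) (he : EqOn e' e (Icc a b))
    (hu : EqOn u' u (Ioo a b)) : IsSolution f u' e' a b := by
  obtain ⟨hc, D, hD, hd⟩ := h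
  refine ⟨hc.congr he, D ∪ {a, b}, hD.union (by simp), fun t ht => ?_⟩
  simp only [mem_union, mem_insert_iff, mem_singleton_iff, not_or, Set.mem_sdiff] at ht
  have ht' : t ∈ Ioo a b :=
    ⟨lt_of_le_of_ne ht.1.1 (Ne.symm ht.2.2.1), lt_of_le_of_ne ht.1.2 ht.2.2.2⟩
  rw [he ht.1, hu ht']
  exact (hd t ⟨ht.1, ht.2.1⟩).congr he (he ht.1)

theorem IsSolution.trans (hab : a ≤ b) (hbc : b ≤ c) (h₁ : IsSolution f u e a b)
    (h₂ : IsSolution f u e b c) : IsSolution f u e a c := by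
  obtain ⟨hc, D, hD, hd⟩ := h₁
  obtain ⟨hc', D', hD', hd'⟩ := h₂
  refine ⟨?_, D ∪ D' ∪ {b}, (hD.union hD').union (finite_singleton b), fun t ht => ?_⟩
  · rw [← Icc_union_Icc_eq_Icc hab hbc]
    exact hc.union_of_isClosed hc' isClosed_Icc isClosed_Icc
  · simp only [mem_union, mem_singleton_iff, not_or, Set.mem_sdiff] at ht
    rcases lt_or_gt_of_ne ht.2.2 with hb | hb
    · refine (hd t ⟨⟨ht.1.1, hb.le⟩, ht.2.1.1⟩).mono_of_mem_nhdsWithin ?_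
      filter_upwards [self_mem_nhdsWithin, mem_nhdsWithin_of_mem_nhds (Iio_mem_nhds hb)]
        with s hs hs' using ⟨hs.1, le_of_lt hs'⟩
    · refine (hd' t ⟨⟨hb.le, ht.1.2⟩, ht.2.1.2⟩).mono_of_mem_nhdsWithin ?_
      filter_upwards [self_mem_nhdsWithin, mem_nhdsWithin_of_mem_nhds (Ioi_mem_nhds hb)]
        with s hs hs' using ⟨le_of_lt hs', hs.2⟩

/-- Uniqueness of solutions for a right-hand side that is locally Lipschitz along one of them. -/
theorem IsSolution.eqOn [NormedAddCommGroup U] (h₁ : IsSolution f u e a b)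
    (h₂ : IsSolution f u e' a b)
    (hu : ∀ t ∈ Ico a b, ∃ l, Tendsto u (𝓝[>] t) (𝓝 l))
    (hf : ∀ t ∈ Icc a b, ∀ l, ∃ K, ∃ s ∈ 𝓝 (e t, l),
      LipschitzOnWith K (fun p : E × U => f p.1 p.2) s)
    (h0 : e a = e' a) : EqOn e e' (Icc a b) := by
  obtain ⟨hc₁, D₁, hD₁, hd₁⟩ := h₁
  obtain ⟨hc₂, D₂, hD₂, hd₂⟩ := h₂
  have hcl : IsClosed ({t | e t = e' t} ∩ Icc a b) := by
    have := (hc₁.sub hc₂).preimage_isClosed_of_isClosed isClosed_Icc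
      (isClosed_singleton (x := (0 : E)))
    convert this using 1
    ext t
    simp [sub_eq_zero, and_comm]
  -- Continuation argument: the coincidence set is closed and contains `a`, so it is enough to
  -- extend it to the right of each of its points.
  refine hcl.Icc_subset_of_forall_mem_nhdsWithin h0 ?_
  rintro x ⟨hx, hxab⟩
  obtain ⟨l, hl⟩ := hu x hxab
  obtain ⟨K, s, hs, hK⟩ := hf x (Ico_subset_Icc_self hxab) l
  have hIcc : Icc a b ∈ 𝓝[>] x :=
    mem_of_superset (Ioc_mem_nhdsGT hxab.2) fun t ht => ⟨hxab.1.trans ht.1.le, ht.2⟩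
  have ht₁ : Tendsto e (𝓝[>] x) (𝓝 (e x)) :=
    (hc₁ x (Ico_subset_Icc_self hxab)).mono_of_mem_nhdsWithin hIcc
  have ht₂ : Tendsto e' (𝓝[>] x) (𝓝 (e' x)) :=
    (hc₂ x (Ico_subset_Icc_self hxab)).mono_of_mem_nhdsWithin hIcc
  have hs₁ : ∀ᶠ t in 𝓝[>] x, (e t, u t) ∈ s := (ht₁.prodMk_nhds hl) hs
  have hs₂ : ∀ᶠ t in 𝓝[>] x, (e' t, u t) ∈ s := by
    refine (ht₂.prodMk_nhds hl) ?_
    rwa [← show e x = e' x from hx]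
  have hfin : ∀ᶠ t in 𝓝[>] x, t ∉ D₁ ∪ D₂ := by
    have h3 : ((D₁ ∪ D₂) \ {x})ᶜ ∈ 𝓝 x :=
      ((hD₁.union hD₂).sdiff).isClosed.isOpen_compl.mem_nhds (by simp)
    filter_upwards [mem_nhdsWithin_of_mem_nhds h3, self_mem_nhdsWithin] with t ht ht' hD
    exact ht ⟨hD, ne_of_gt ht'⟩
  -- On `(x, δ)` there are no exceptional points and both pairs (state, input) remain in one
  -- Lipschitz neighbourhood of `(e x, l)`. The right limit `l` replaces `u x`, since the input may
  -- jump at `x`.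
  obtain ⟨δ, hδ, hall⟩ := (mem_nhdsGT_iff_exists_Ioo_subset).1
    (hs₁.and (hs₂.and (hfin.and (Ioo_mem_nhdsGT hxab.2))))
  refine mem_of_superset (Ioo_mem_nhdsGT hδ) fun t ht => ?_
  -- Grönwall is applied on `[r, t]` with `r > x`, as `x` may itself be exceptional. Letting `r`
  -- decrease to `x`, where the solutions agree, gives distance zero.
  have hbound : ∀ᶠ r in 𝓝[>] x,
      dist (e t) (e' t) ≤ dist (e r) (e' r) * Real.exp (K * (t - r)) := by
    filter_upwards [Ioo_mem_nhdsGT ht.1] with r hr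
    have hall' : ∀ y ∈ Icc r t, _ := fun y hy =>
      hall (show y ∈ Ioo x δ from ⟨hr.1.trans_le hy.1, hy.2.trans_lt ht.2⟩)
    have hsub : Icc r t ⊆ Icc a b := fun y hy =>
      ⟨hxab.1.trans (hall' y hy).2.2.2.1.le, (hall' y hy).2.2.2.2.le⟩
    have hnear : ∀ y ∈ Ico r t, Icc a b ∈ 𝓝[≥] y := fun y hy => by
      have h4 := (hall' y (Ico_subset_Icc_self hy)).2.2.2
      exact mem_nhdsWithin_of_mem_nhds (Icc_mem_nhds (hxab.1.trans_lt h4.1) h4.2)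
    refine dist_le_of_trajectories_ODE_of_mem (v := fun y z => f z (u y))
      (s := fun y => {z | (z, u y) ∈ s}) (K := K) ?_ (hc₁.mono hsub) ?_ ?_ (hc₂.mono hsub) ?_ ?_
      le_rfl t (right_mem_Icc.2 hr.2.le)
    · intro y hy z hz w hw
      simpa [Prod.edist_eq] using hK hz hw
    · intro y hy
      have h4 := hall' y (Ico_subset_Icc_self hy)
      have h5 := hd₁ y ⟨hsub (Ico_subset_Icc_self hy), fun h => h4.2.2.1 (Or.inl h)⟩
      exact h5.mono_of_mem_nhdsWithin (hnear y hy)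
    · exact fun y hy => (hall' y (Ico_subset_Icc_self hy)).1
    · intro y hy
      have h4 := hall' y (Ico_subset_Icc_self hy)
      have h5 := hd₂ y ⟨hsub (Ico_subset_Icc_self hy), fun h => h4.2.2.1 (Or.inr h)⟩
      exact h5.mono_of_mem_nhdsWithin (hnear y hy)
    · exact fun y hy => (hall' y (Ico_subset_Icc_self hy)).2.1
  have hlim : Tendsto (fun r => dist (e r) (e' r) * Real.exp (K * (t - r))) (𝓝[>] x)
      (𝓝 (dist (e x) (e' x) * Real.exp (K * (t - x)))) := by
    refine (ht₁.dist ht₂).mul ?_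
    have : Continuous fun r : ℝ => Real.exp (K * (t - r)) := by fun_prop
    exact (this.tendsto x).mono_left nhdsWithin_le_nhds
  have h5 := ge_of_tendsto hlim hbound
  rw [show e x = e' x from hx, dist_self, zero_mul] at h5
  exact dist_le_zero.1 h5

end Solution

/-- A dissipation inequality along a solution integrates. -/
theorem IsSolution.add_integral_le {E U : Type*} [NormedAddCommGroup E] [NormedSpace ℝ E]
    {f : E → U → E} {u : ℝ → U} {e : ℝ → E} {a b : ℝ} (hab : a ≤ b) (h : IsSolution f u e a b)
    {V : E → ℝ} (hV : Differentiable ℝ V) {φ : ℝ → ℝ} (hφ : PiecewiseContinuousOn φ a b)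
    (hle : ∀ s ∈ Icc a b, fderiv ℝ V (e s) (f (e s) (u s)) + φ s ≤ 0) :
    V (e b) + ∫ s in a..b, φ s ≤ V (e a) := by
  obtain ⟨hc, D, hD, hd⟩ := h
  have hint := hφ.intervalIntegrable hab
  obtain ⟨⟨D', hD', hφc⟩, -, -⟩ := hφ
  -- The function `V (e t) + ∫ φ` has nonpositive derivative wherever `e` is differentiable and `φ`
  -- continuous, hence off a finite set.
  have key := sub_le_mul_of_hasDerivWithinAt (φ := fun t => V (e t) + ∫ s in a..t, φ s)
    (a := a) (b := b) (C := 0) (hD.union hD') hab ?_ ?_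
  · simp at key; linarith
  · refine (hV.continuous.comp_continuousOn hc).add ?_
    have := intervalIntegral.continuousOn_primitive_interval' hint (a := a) left_mem_uIcc
    rwa [uIcc_of_le hab] at this
  · intro t ht
    have htI := Ioo_subset_Icc_self ht.1
    refine ⟨_, hle t htI, HasDerivWithinAt.add ?_ ?_⟩
    · exact (hV (e t)).hasFDerivAt.comp_hasDerivWithinAt t
        (hd t ⟨htI, fun h => ht.2 (Or.inl h)⟩)
    · have hnhds : Icc a b \ D' ∈ 𝓝 t := by
        filter_upwards [Icc_mem_nhds ht.1.1 ht.1.2,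
          hD'.isClosed.isOpen_compl.mem_nhds fun h => ht.2 (Or.inr h)] with s h1 h2 using ⟨h1, h2⟩
      have hct : ∀ s ∈ Icc a b \ D', ContinuousWithinAt φ (Icc a b \ D') s :=
        fun s hs => (hφc s hs).mono sdiff_subset
      refine (intervalIntegral.integral_hasDerivAt_right
        (hint.mono_set (by rw [uIcc_of_le hab, uIcc_of_le htI.1]; exact Icc_subset_Icc_right htI.2))
        ?_ ?_).hasDerivWithinAt
      · exact ⟨_, hnhds, ContinuousOn.aestronglyMeasurable hct
          (measurableSet_Icc.diff hD'.measurableSet)⟩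
      · exact (hct t (mem_of_mem_nhds hnhds)).continuousAt hnhds

/-! ### Convergence lemmas of Barbalat type -/

/-- A Lipschitz function whose square has vanishing integral over consecutive intervals of a fixed
length tends to zero. -/
theorem tendsto_zero_of_integral_sq {φ : ℝ → ℝ} {T₀ L h : ℝ} {c : ℕ → ℝ} (hh : 0 < h)
    (hL : ∀ s t, T₀ ≤ s → T₀ ≤ t → |φ s - φ t| ≤ L * |s - t|)
    (hc : Tendsto c atTop (𝓝 0))
    (hint : ∀ j : ℕ, ∫ s in (0 : ℝ)..h, φ (s + j * h) ^ 2 ≤ c j) :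
    Tendsto φ atTop (𝓝 0) := by
  have hL0 : 0 ≤ L := by
    have := hL T₀ (T₀ + 1) le_rfl (by linarith)
    simp at this
    exact (abs_nonneg _).trans this
  have hcont : ContinuousOn φ (Ici T₀) := by
    refine (LipschitzOnWith.of_dist_le_mul (K := ⟨L, hL0⟩) fun s hs t ht => ?_).continuousOn
    rw [Real.dist_eq, Real.dist_eq]
    exact hL s t hs ht
  rw [Metric.tendsto_atTop]
  intro ε hε
  -- Over a time `δ` the function moves by at most `ε / 4`, so `|φ t| ≥ ε` forces `|φ| ≥ ε / 2` on a
  -- window of length `δ`. The bound `h / 2` lets such a window fit inside one interval, and `L + 1`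
  -- avoids division by zero.
  set δ := min (h / 2) (ε / (4 * (L + 1))) with hδ
  have hδ0 : 0 < δ := lt_min (by linarith) (by positivity)
  have hLδ : L * δ ≤ ε / 4 := by
    have h1 : δ ≤ ε / (4 * (L + 1)) := min_le_right _ _
    rw [le_div_iff₀ (by positivity)] at h1
    nlinarith
  have hδh : δ ≤ h / 2 := min_le_left _ _
  obtain ⟨J, hJ⟩ := eventually_atTop.1
    ((hc.eventually_lt_const (show 0 < δ * (ε / 2) ^ 2 by positivity)).and
      (tendsto_natCast_atTop_atTop.eventually_ge_atTop (|T₀| / h)))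
  refine ⟨J * h, fun t ht => ?_⟩
  rw [Real.dist_eq, sub_zero]
  by_contra! hcon
  have ht0 : 0 ≤ t := le_trans (by positivity) ht
  set j := ⌊t / h⌋₊ with hj
  have hj1 : j * h ≤ t := by
    have := Nat.floor_le (div_nonneg ht0 hh.le)
    rwa [le_div_iff₀ hh] at this
  have hj2 : t < (j + 1) * h := by
    have := Nat.lt_floor_add_one (t / h)
    rwa [div_lt_iff₀ hh] at this
  have hJj : J ≤ j := Nat.le_floor (by rwa [le_div_iff₀ hh])
  have hT0 : T₀ ≤ j * h := by
    have := (hJ j hJj).2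
    rw [div_le_iff₀ hh] at this
    exact (le_abs_self _).trans this
  have hci : ContinuousOn (fun s => φ (s + j * h) ^ 2) (Icc 0 h) := by
    refine (hcont.comp (by fun_prop) fun s hs => ?_).pow 2
    simp only [mem_Ici]; linarith [hs.1]
  have hii : IntervalIntegrable (fun s => φ (s + j * h) ^ 2) MeasureTheory.volume 0 h :=
    ContinuousOn.intervalIntegrable (by rwa [uIcc_of_le hh.le])
  -- The window extends to the right of `t` when `t` is in the first half of its interval, and to
  -- the left otherwise.
  obtain ⟨p, hp0, hph, hpt⟩ : ∃ p, 0 ≤ p ∧ p + δ ≤ h ∧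
      ∀ s ∈ Icc p (p + δ), |s + j * h - t| ≤ δ := by
    rcases le_total (t - j * h) (h / 2) with hcase | hcase
    · refine ⟨t - j * h, by linarith, by linarith, fun s hs => ?_⟩
      rw [abs_le]; constructor <;> linarith [hs.1, hs.2]
    · refine ⟨t - j * h - δ, by linarith, by linarith, fun s hs => ?_⟩
      rw [abs_le]; constructor <;> linarith [hs.1, hs.2]
  have hlow : ∀ s ∈ Icc p (p + δ), (ε / 2) ^ 2 ≤ φ (s + j * h) ^ 2 := by
    intro s hs
    have h1 := hL t (s + j * h) (by linarith) (by linarith [hs.1])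
    rw [abs_sub_comm t] at h1
    have h2 : L * |s + j * h - t| ≤ L * δ := mul_le_mul_of_nonneg_left (hpt s hs) hL0
    have h3 := abs_sub_abs_le_abs_sub (φ t) (φ (s + j * h))
    rw [← sq_abs (φ _)]
    exact pow_le_pow_left₀ (by positivity) (by linarith) 2
  have h4 : δ * (ε / 2) ^ 2 ≤ ∫ s in p..(p + δ), φ (s + j * h) ^ 2 := by
    have h5 := intervalIntegral.integral_mono_on (a := p) (b := p + δ)
      (f := fun _ => (ε / 2) ^ 2) (g := fun s => φ (s + j * h) ^ 2)
      (μ := MeasureTheory.volume) (by linarith) intervalIntegrable_const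
      (hii.mono_set (by
        rw [uIcc_of_le hh.le, uIcc_of_le (by linarith)]; exact Icc_subset_Icc hp0 hph)) hlow
    simpa using h5
  have h6 : ∫ s in p..(p + δ), φ (s + j * h) ^ 2 ≤ ∫ s in (0 : ℝ)..h, φ (s + j * h) ^ 2 :=
    intervalIntegral.integral_mono_interval hp0 (by linarith) hph
      (Eventually.of_forall fun s => sq_nonneg _) hii
  linarith [hint j, (hJ j hJj).1]

/-- **Barbalat's lemma**: if `φ → 0` and `φ̇ = ψ` off finite sets with `ψ` uniformly continuous,
then `ψ → 0`. -/
theorem tendsto_zero_of_hasDerivWithinAt {φ ψ : ℝ → ℝ} {T₀ : ℝ}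
    (hφ : Tendsto φ atTop (𝓝 0)) (hcont : ContinuousOn φ (Ici T₀))
    (hderiv : ∀ a b, T₀ ≤ a → a ≤ b → ∃ D : Set ℝ, D.Finite ∧
      ∀ t ∈ Icc a b \ D, HasDerivWithinAt φ (ψ t) (Icc a b) t)
    (hψ : UniformContinuousOn ψ (Ici T₀)) : Tendsto ψ atTop (𝓝 0) := by
  rw [Metric.tendsto_atTop]
  intro ε hε
  obtain ⟨δ, hδ, hδψ⟩ := Metric.uniformContinuousOn_iff.1 hψ (ε / 2) (by linarith)
  -- Over a time `δ / 2` the increment of `φ` differs from `(δ / 2) * ψ t` by at most `εδ / 4`, and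
  -- it is itself below `εδ / 8` in size. Together these give `|ψ t| < 3ε / 4`.
  obtain ⟨T, hT⟩ := Metric.tendsto_atTop.1 hφ (ε * δ / 16) (by positivity)
  refine ⟨max T T₀, fun t ht => ?_⟩
  have htT : T ≤ t := (le_max_left _ _).trans ht
  have htT₀ : T₀ ≤ t := (le_max_right _ _).trans ht
  obtain ⟨D, hD, hd⟩ := hderiv t (t + δ / 2) htT₀ (by linarith)
  have h1 := abs_sub_le_mul_of_hasDerivWithinAt (φ := fun s => φ s - s * ψ t) (C := ε / 2)
    (a := t) (b := t + δ / 2) hD (by linarith) ?_ ?_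
  · have h2 := hT t htT
    have h3 := hT (t + δ / 2) (by linarith)
    rw [Real.dist_eq, sub_zero, abs_lt] at h2 h3
    rw [abs_le] at h1
    rw [Real.dist_eq, sub_zero, abs_lt]
    constructor
    · by_contra! hcon
      nlinarith [h1.1, h1.2]
    · by_contra! hcon
      nlinarith [h1.1, h1.2]
  · exact (hcont.mono fun s hs => htT₀.trans hs.1).sub (by fun_prop)
  · intro s hs
    refine ⟨ψ s - ψ t, ?_, ?_⟩
    · have := hδψ s (htT₀.trans hs.1.1.le) t htT₀ (by
        rw [Real.dist_eq, abs_lt]; constructor <;> linarith [hs.1.1, hs.1.2])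
      exact this.le
    · have := (hasDerivAt_id s).mul_const (ψ t)
      simp only [one_mul, id] at this
      exact (hd s ⟨Ioo_subset_Icc_self hs.1, hs.2⟩).sub this.hasDerivWithinAt

end CoopNMPC

namespace CoopNMPC

/-! ### Smoothness of matrix-valued maps -/

/-- Entrywise smoothness of a matrix-valued map. -/
def MatContDiffAt {E ι κ : Type*} [NormedAddCommGroup E] [NormedSpace ℝ E] (k : WithTop ℕ∞)
    (A : E → Matrix ι κ ℝ) (x : E) : Prop :=
  ∀ i j, ContDiffAt ℝ k (fun y => A y i j) x

section MatContDiffAt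

variable {E ι κ l : Type*} [NormedAddCommGroup E] [NormedSpace ℝ E] {k : WithTop ℕ∞} {x : E}
  [Fintype κ]

theorem MatContDiffAt.mul {A : E → Matrix ι κ ℝ} {B : E → Matrix κ l ℝ}
    (hA : MatContDiffAt k A x) (hB : MatContDiffAt k B x) :
    MatContDiffAt k (fun y => A y * B y) x := fun i j => by
  simp only [Matrix.mul_apply]
  exact ContDiffAt.sum fun a _ => (hA i a).mul (hB a j)

theorem MatContDiffAt.mulVec [Fintype ι] {A : E → Matrix ι κ ℝ} {v : E → κ → ℝ}
    (hA : MatContDiffAt k A x) (hv : ContDiffAt ℝ k v x) :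
    ContDiffAt ℝ k (fun y => A y *ᵥ v y) x := by
  refine contDiffAt_pi.2 fun i => ?_
  simp only [Matrix.mulVec, dotProduct]
  exact ContDiffAt.sum fun a _ => (hA i a).mul (contDiffAt_pi.1 hv a)

theorem MatContDiffAt.add {A B : E → Matrix ι l ℝ} (hA : MatContDiffAt k A x)
    (hB : MatContDiffAt k B x) : MatContDiffAt k (fun y => A y + B y) x :=
  fun i j => (hA i j).add (hB i j)

theorem MatContDiffAt.sub {A B : E → Matrix ι l ℝ} (hA : MatContDiffAt k A x)
    (hB : MatContDiffAt k B x) : MatContDiffAt k (fun y => A y - B y) x :=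
  fun i j => (hA i j).sub (hB i j)

theorem MatContDiffAt.transpose {A : E → Matrix ι l ℝ} (hA : MatContDiffAt k A x) :
    MatContDiffAt k (fun y => (A y)ᵀ) x := fun i j => hA j i

theorem MatContDiffAt.det [DecidableEq κ] {A : E → Matrix κ κ ℝ} (hA : MatContDiffAt k A x) :
    ContDiffAt ℝ k (fun y => (A y).det) x := by
  simp only [Matrix.det_apply]
  exact ContDiffAt.sum fun σ _ => (contDiffAt_prod fun i _ => hA (σ i) i).const_smul _

/-- Cramer's rule: the inverse is the adjugate divided by the determinant, and each entry of the
adjugate is the determinant of a matrix with one row made constant. -/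
theorem MatContDiffAt.inv [DecidableEq κ] {A : E → Matrix κ κ ℝ} (hA : MatContDiffAt k A x)
    (h : (A x).det ≠ 0) : MatContDiffAt k (fun y => (A y)⁻¹) x := fun i j => by
  simp only [Matrix.inv_def, Matrix.smul_apply, Ring.inverse_eq_inv', smul_eq_mul,
    Matrix.adjugate_apply]
  refine (hA.det.inv h).mul (MatContDiffAt.det fun a b => ?_)
  simp only [Matrix.updateRow_apply]
  split_ifs
  · exact contDiffAt_const
  · exact hA a b

theorem MatContDiffAt.comp {F : Type*} [NormedAddCommGroup F] [NormedSpace ℝ F]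
    {A : F → Matrix ι l ℝ} {q : E → F} (hA : MatContDiffAt k A (q x)) (hq : ContDiffAt ℝ k q x) :
    MatContDiffAt k (fun y => A (q y)) x :=
  fun i j => (hA i j).comp x hq

theorem matContDiffAt_dirDeriv {m : ℕ} {A : Cfg m → Matrix ι l ℝ} {k' : WithTop ℕ∞}
    (hA : ∀ i j, ContDiff ℝ k' fun q => A q i j) (hk : k + 1 ≤ k') {q w : E → Cfg m}
    (hq : ContDiffAt ℝ k q x) (hw : ContDiffAt ℝ k w x) :
    MatContDiffAt k (fun y => dirDeriv A (q y) (w y)) x := fun i j => by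
  simp only [dirDeriv, Matrix.of_apply]
  exact (((hA i j).fderiv_right hk).contDiffAt.comp x hq).clm_apply hw

end MatContDiffAt

namespace Agent

variable {m : ℕ} (A : Agent m)

theorem contDiff_jac (r : Six) (c : Fin m) : ContDiff ℝ ∞ fun q => A.jac q r c := by
  rcases r with a | a
  · simp only [jac, Matrix.of_apply]
    exact ((contDiff_pi.1 A.pE_smooth a).fderiv_right (m := ∞) le_rfl).clm_apply contDiff_const
  · simp only [jac, Matrix.of_apply]
    have key : ∀ i j, ContDiff ℝ ∞ fun q =>
        (dirDeriv A.rot q (Pi.single c 1) * (A.rot q)ᵀ) i j := fun i j =>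
      contDiff_iff_contDiffAt.2 fun q => (matContDiffAt_dirDeriv (k := ∞) A.rot_smooth le_rfl
        contDiffAt_id contDiffAt_const).mul
          (MatContDiffAt.transpose fun a b => (A.rot_smooth a b).contDiffAt) i j
    fin_cases a
    · exact key 2 1
    · exact key 0 2
    · exact key 1 0

theorem contDiff_objJac (r c : Six) : ContDiff ℝ ∞ fun q => A.objJac q r c := by
  have h1 : ∀ i, ContDiff ℝ ∞ fun q => (A.rot q *ᵥ A.offset) i := fun i =>
    contDiff_iff_contDiffAt.2 fun q => contDiffAt_pi.1 (MatContDiffAt.mulVec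
      (fun a b => (A.rot_smooth a b).contDiffAt) contDiffAt_const) i
  rcases r with a | a <;> rcases c with b | b
  · exact contDiff_const
  · simp only [objJac, Matrix.fromBlocks_apply₁₂, Matrix.neg_apply]
    refine ContDiff.neg ?_
    fin_cases a <;> fin_cases b
    · exact contDiff_const
    · exact (h1 2).neg
    · exact h1 1
    · exact h1 2
    · exact contDiff_const
    · exact (h1 0).neg
    · exact (h1 1).neg
    · exact h1 0
    · exact contDiff_const
  · exact contDiff_const
  · exact contDiff_const

/-- Invertibility of `J Jᵀ` makes `v ↦ v J` injective, and a congruence by such a `J` preserves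
positive definiteness. -/
theorem posDef_mul_mul_transpose {q : Cfg m} (hq : q ∈ A.nonsing) :
    (A.jac q * (A.inertia q)⁻¹ * (A.jac q)ᵀ).PosDef := by
  have h := (A.inertia_posDef q).inv.mul_mul_conjTranspose_same (B := A.jac q) ?_
  · simpa using h
  · intro v w hvw
    have hu : IsUnit (A.jac q * (A.jac q)ᵀ) :=
      (Matrix.isUnit_iff_isUnit_det _).2 (isUnit_iff_ne_zero.2 (ne_of_gt hq))
    refine Matrix.vecMul_injective_of_isUnit hu ?_
    simp only [← Matrix.vecMul_vecMul]
    exact congrArg (fun z => z ᵥ* (A.jac q)ᵀ) hvw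

theorem posDef_taskInertia {q : Cfg m} (hq : q ∈ A.nonsing) : (A.taskInertia q).PosDef :=
  (A.posDef_mul_mul_transpose hq).inv

theorem jac_mul_pinv {q : Cfg m} (hq : q ∈ A.nonsing) : A.jac q * A.pinv q = 1 := by
  rw [pinv, ← Matrix.mul_assoc]
  exact Matrix.mul_nonsing_inv _ (isUnit_iff_ne_zero.2 (ne_of_gt hq))

theorem det_objJac (q : Cfg m) : (A.objJac q).det = 1 := by
  simp [objJac]

variable {E : Type*} [NormedAddCommGroup E] [NormedSpace ℝ E] {x : E} {q w : E → Cfg m}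

theorem matContDiffAt_jac (hq : ContDiffAt ℝ 1 q x) : MatContDiffAt 1 (fun y => A.jac (q y)) x :=
  fun i j => ((A.contDiff_jac i j).of_le (by simp)).contDiffAt.comp x hq

theorem matContDiffAt_objJac (hq : ContDiffAt ℝ 1 q x) :
    MatContDiffAt 1 (fun y => A.objJac (q y)) x :=
  fun i j => ((A.contDiff_objJac i j).of_le (by simp)).contDiffAt.comp x hq

theorem matContDiffAt_pinv (hq : ContDiffAt ℝ 1 q x) (hx : q x ∈ A.nonsing) :
    MatContDiffAt 1 (fun y => A.pinv (q y)) x := by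
  have hJ := A.matContDiffAt_jac hq
  exact hJ.transpose.mul ((hJ.mul hJ.transpose).inv (ne_of_gt hx))

theorem matContDiffAt_inertia_inv (hq : ContDiffAt ℝ 1 q x) :
    MatContDiffAt 1 (fun y => (A.inertia (q y))⁻¹) x :=
  MatContDiffAt.inv (fun i j => ((A.inertia_smooth i j).of_le (by norm_num)).contDiffAt.comp x hq)
    (A.inertia_posDef _).det_pos.ne'

theorem matContDiffAt_taskInertia (hq : ContDiffAt ℝ 1 q x) (hx : q x ∈ A.nonsing) :
    MatContDiffAt 1 (fun y => A.taskInertia (q y)) x := by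
  have hJ := A.matContDiffAt_jac hq
  exact ((hJ.mul (A.matContDiffAt_inertia_inv hq)).mul hJ.transpose).inv
    (A.posDef_mul_mul_transpose hx).det_pos.ne'

/-- The Christoffel symbols contain first derivatives of the inertia matrix, so its `C²` regularity
leaves exactly `C¹` here. -/
theorem matContDiffAt_coriolis (hq : ContDiffAt ℝ 1 q x) (hw : ContDiffAt ℝ 1 w x) :
    MatContDiffAt 1 (fun y => A.coriolis (q y) (w y)) x := fun i j => by
  simp only [coriolis, Matrix.of_apply]
  have h : ∀ a b c, ContDiffAt ℝ 1
      (fun y => fderiv ℝ (fun q' => A.inertia q' a b) (q y) (Pi.single c 1)) x := fun a b c =>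
    (((A.inertia_smooth a b).fderiv_right (m := 1) (by norm_num)).contDiffAt.comp x hq).clm_apply
      contDiffAt_const
  exact ContDiffAt.sum fun l _ => (contDiffAt_const.mul
    (((h _ _ _).add (h _ _ _)).sub (h _ _ _))).mul (contDiffAt_pi.1 hw l)

theorem matContDiffAt_taskCoriolis (hq : ContDiffAt ℝ 1 q x) (hw : ContDiffAt ℝ 1 w x)
    (hx : q x ∈ A.nonsing) : MatContDiffAt 1 (fun y => A.taskCoriolis (q y) (w y)) x :=
  ((A.matContDiffAt_taskInertia hq hx).mul
    ((((A.matContDiffAt_jac hq).mul (A.matContDiffAt_inertia_inv hq)).mul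
      (A.matContDiffAt_coriolis hq hw)).sub
      (matContDiffAt_dirDeriv (k' := ∞) A.contDiff_jac (WithTop.coe_le_coe.2 (le_top (a := (1 + 1 : ℕ∞)))) hq hw))).mul
    (A.matContDiffAt_pinv hq hx)

theorem contDiffAt_taskGravity (hq : ContDiffAt ℝ 1 q x) (hx : q x ∈ A.nonsing) :
    ContDiffAt ℝ 1 (fun y => A.taskGravity (q y)) x :=
  (((A.matContDiffAt_taskInertia hq hx).mul (A.matContDiffAt_jac hq)).mul
    (A.matContDiffAt_inertia_inv hq)).mulVec (A.gravity_smooth.contDiffAt.comp x hq)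

theorem contDiffAt_jointVel {v : E → Six → ℝ} (hq : ContDiffAt ℝ 1 q x) (hv : ContDiffAt ℝ 1 v x)
    (hx : q x ∈ A.nonsing) : ContDiffAt ℝ 1 (fun y => A.jointVel (q y) (v y)) x :=
  (A.matContDiffAt_pinv hq hx).mulVec ((A.matContDiffAt_objJac hq).mulVec hv)

theorem isOpen_nonsing : IsOpen A.nonsing := by
  have : Continuous fun q => (A.jac q * (A.jac q)ᵀ).det :=
    continuous_iff_continuousAt.2 fun q =>
      ((A.matContDiffAt_jac contDiffAt_id).mul
        (A.matContDiffAt_jac contDiffAt_id).transpose).det.continuousAt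
  exact isOpen_lt continuous_const this

end Agent

/-! ### Smoothness of the coupled dynamics -/

section Coupled

variable {N : ℕ} {n : Fin N → ℕ} {Z : ℕ} (S : CoopSystem n Z)

theorem matContDiffAt_objRepJac {E : Type*} [NormedAddCommGroup E] [NormedSpace ℝ E] {x : E}
    {η : E → Fin 3 → ℝ} (hη : ContDiffAt ℝ 1 η x) (hx : Real.cos (η x 1) ≠ 0) :
    MatContDiffAt 1 (fun y => objRepJac (η y)) x := by
  have h := fun i => contDiffAt_pi.1 hη i
  have hsin := fun i => Real.contDiff_sin.contDiffAt.comp x (h i)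
  have hcos := fun i => Real.contDiff_cos.contDiffAt.comp x (h i)
  have htan : ContDiffAt ℝ 1 (fun y => Real.tan (η y 1)) x :=
    ContDiffAt.comp (g := Real.tan) (f := fun y => η y 1) x (Real.contDiffAt_tan.2 hx) (h 1)
  intro a b
  rcases a with a | a <;> rcases b with b | b
  · exact contDiffAt_const
  · exact contDiffAt_const
  · exact contDiffAt_const
  · fin_cases a <;> fin_cases b
    · exact contDiffAt_const
    · exact (hsin 0).mul htan
    · exact (hcos 0).mul htan
    · exact contDiffAt_const
    · exact hcos 0
    · exact (hsin 0).neg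
    · exact contDiffAt_const
    · exact (hsin 0).div (hcos 1) hx
    · exact (hcos 0).div (hcos 1) hx

namespace CoopSystem

/-- The open set of states at which the coupled dynamics is regular. -/
def regular : Set (State n) :=
  {x | Real.cos (State.euler x 1) ≠ 0 ∧ ∀ i, State.joint x i ∈ (S.agent i).nonsing}

theorem continuous_joint (i : Fin N) : Continuous fun x : State n => State.joint x i := by
  unfold State.joint; fun_prop

theorem isOpen_regular : IsOpen S.regular := by
  have h1 : Continuous fun x : State n => Real.cos (State.euler x 1) := by
    unfold State.euler; fun_prop
  have h2 : S.regular = {x | Real.cos (State.euler x 1) ≠ 0} ∩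
      ⋂ i, (fun x => State.joint x i) ⁻¹' (S.agent i).nonsing := by
    ext x; simp [regular]
  rw [h2]
  exact (isOpen_ne_fun h1 continuous_const).inter
    (isOpen_iInter_of_finite fun i => (S.agent i).isOpen_nonsing.preimage (continuous_joint i))

theorem stateSet_subset_regular : S.stateSet ⊆ S.regular := fun x hx => by
  refine ⟨(Real.cos_pos_of_mem_Ioo ⟨?_, ?_⟩).ne', hx.2.2.1⟩
  · linarith [hx.1.1, S.thetaBar_lt]
  · linarith [hx.1.2, S.thetaBar_lt]

/-- The quadratic form of a block-diagonal matrix is the sum of those of its blocks.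
Semidefiniteness suffices, because the object inertia that is added to this term is definite. -/
theorem posSemidef_grasp_mul {x : State n} (hx : x ∈ S.regular) :
    (S.grasp x * S.stackInertia x * (S.grasp x)ᵀ).PosSemidef := by
  have h : (S.stackInertia x).PosSemidef := by
    refine Matrix.PosSemidef.of_dotProduct_mulVec_nonneg ?_ fun v => ?_
    · rw [Matrix.IsHermitian, stackInertia, Matrix.blockDiagonal_conjTranspose]
      congr 1
      ext1 i
      exact ((S.agent i).posDef_taskInertia (hx.2 i)).isHermitian
    · have : star v ⬝ᵥ (S.stackInertia x *ᵥ v) = ∑ i, star (fun s => v (s, i)) ⬝ᵥ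
          ((S.agent i).taskInertia (State.joint x i) *ᵥ fun s => v (s, i)) := by
        simp only [dotProduct, Matrix.mulVec, stackInertia, Matrix.blockDiagonal_apply,
          Fintype.sum_prod_type_right, ite_mul, zero_mul, Pi.star_apply]
        simp
      rw [this]
      exact Finset.sum_nonneg fun i _ =>
        ((S.agent i).posDef_taskInertia (hx.2 i)).posSemidef.dotProduct_mulVec_nonneg _
  simpa using h.mul_mul_conjTranspose_same (S.grasp x)

theorem det_coupledInertia_ne_zero {x : State n} (hx : x ∈ S.regular) :
    (S.coupledInertia x).det ≠ 0 :=
  ((S.objInertia_posDef _).add_posSemidef (S.posSemidef_grasp_mul hx)).det_pos.ne'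

theorem contDiffAt_joint (i : Fin N) (x : State n) :
    ContDiffAt ℝ 1 (fun y : State n => State.joint y i) x := by
  unfold State.joint; fun_prop

theorem contDiffAt_euler (x : State n) : ContDiffAt ℝ 1 (State.euler (n := n)) x := by
  unfold State.euler; fun_prop

theorem contDiffAt_twist (x : State n) : ContDiffAt ℝ 1 (State.twist (n := n)) x := by
  unfold State.twist; fun_prop

theorem contDiffAt_omega (x : State n) : ContDiffAt ℝ 1 (State.omega (n := n)) x := by
  unfold State.omega; fun_prop

theorem contDiffAt_qdot {x : State n} (hx : x ∈ S.regular) (i : Fin N) :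
    ContDiffAt ℝ 1 (fun y => S.qdot y i) x :=
  (S.agent i).contDiffAt_jointVel (contDiffAt_joint i x) (contDiffAt_twist x) (hx.2 i)

theorem matContDiffAt_grasp (x : State n) : MatContDiffAt 1 S.grasp x := fun r c =>
  (S.agent c.2).matContDiffAt_objJac (contDiffAt_joint c.2 x) c.1 r

theorem matContDiffAt_graspDot {x : State n} (hx : x ∈ S.regular) :
    MatContDiffAt 1 S.graspDot x := fun r c =>
  matContDiffAt_dirDeriv (k' := ∞) (S.agent c.2).contDiff_objJac (WithTop.coe_le_coe.2 (le_top (a := (1 + 1 : ℕ∞))))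
    (contDiffAt_joint c.2 x) (S.contDiffAt_qdot hx c.2) c.1 r

theorem matContDiffAt_blockDiagonal {E : Type*} [NormedAddCommGroup E] [NormedSpace ℝ E]
    {B : Fin N → E → Matrix Six Six ℝ} {x : E} (h : ∀ i, MatContDiffAt 1 (B i) x) :
    MatContDiffAt 1 (fun y => Matrix.blockDiagonal fun i => B i y) x := fun r c => by
  simp only [Matrix.blockDiagonal_apply]
  split_ifs
  · exact h _ _ _
  · exact contDiffAt_const

theorem matContDiffAt_stackInertia {x : State n} (hx : x ∈ S.regular) :
    MatContDiffAt 1 S.stackInertia x :=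
  matContDiffAt_blockDiagonal fun i =>
    (S.agent i).matContDiffAt_taskInertia (contDiffAt_joint i x) (hx.2 i)

theorem matContDiffAt_stackCoriolis {x : State n} (hx : x ∈ S.regular) :
    MatContDiffAt 1 S.stackCoriolis x :=
  matContDiffAt_blockDiagonal fun i => (S.agent i).matContDiffAt_taskCoriolis
    (contDiffAt_joint i x) (S.contDiffAt_qdot hx i) (hx.2 i)

theorem contDiffAt_stackGravity {x : State n} (hx : x ∈ S.regular) :
    ContDiffAt ℝ 1 S.stackGravity x :=
  contDiffAt_pi.2 fun c => contDiffAt_pi.1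
    ((S.agent c.2).contDiffAt_taskGravity (contDiffAt_joint c.2 x) (hx.2 c.2)) c.1

theorem matContDiffAt_coupledInertia {x : State n} (hx : x ∈ S.regular) :
    MatContDiffAt 1 S.coupledInertia x :=
  MatContDiffAt.add
    (fun a b => (S.objInertia_smooth a b).contDiffAt.comp x (contDiffAt_euler x))
    (((S.matContDiffAt_grasp x).mul (S.matContDiffAt_stackInertia hx)).mul
      (S.matContDiffAt_grasp x).transpose)

theorem matContDiffAt_coupledCoriolis {x : State n} (hx : x ∈ S.regular) :
    MatContDiffAt 1 S.coupledCoriolis x :=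
  (MatContDiffAt.add
    (fun a b => (S.objCoriolis_smooth a b).contDiffAt.comp x
      ((contDiffAt_euler x).prodMk (contDiffAt_omega x)))
    (((S.matContDiffAt_grasp x).mul (S.matContDiffAt_stackCoriolis hx)).mul
      (S.matContDiffAt_grasp x).transpose)).add
    (((S.matContDiffAt_grasp x).mul (S.matContDiffAt_stackInertia hx)).mul
      (S.matContDiffAt_graspDot hx).transpose)

/-- The coupled dynamics is continuously differentiable at regular states. -/
theorem contDiffAt_dyn {x : State n} (hx : x ∈ S.regular) (u : Input N) :
    ContDiffAt ℝ 1 (fun p : State n × Input N => S.dyn p.1 p.2) (x, u) := by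
  have hfst : ContDiffAt ℝ 1 (Prod.fst : State n × Input N → State n) (x, u) := contDiffAt_fst
  have hsnd : ContDiffAt ℝ 1 (Prod.snd : State n × Input N → Input N) (x, u) := contDiffAt_snd
  have htw : ContDiffAt ℝ 1 (fun p : State n × Input N => State.twist p.1) (x, u) :=
    ContDiffAt.comp (g := State.twist) (x, u) (contDiffAt_twist x) hfst
  have heu : ContDiffAt ℝ 1 (fun p : State n × Input N => State.euler p.1) (x, u) :=
    ContDiffAt.comp (g := State.euler) (x, u) (contDiffAt_euler x) hfst
  have hgrav : ContDiffAt ℝ 1 (fun p : State n × Input N => S.stackGravity p.1) (x, u) :=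
    ContDiffAt.comp (x, u) (S.contDiffAt_stackGravity hx) hfst
  have hgrasp : MatContDiffAt 1 (fun p : State n × Input N => S.grasp p.1) (x, u) :=
    MatContDiffAt.comp (x := (x, u)) (S.matContDiffAt_grasp x) hfst
  have hcor : MatContDiffAt 1 (fun p : State n × Input N => S.coupledCoriolis p.1) (x, u) :=
    MatContDiffAt.comp (x := (x, u)) (S.matContDiffAt_coupledCoriolis hx) hfst
  have hin : MatContDiffAt 1 (fun p : State n × Input N => S.coupledInertia p.1) (x, u) :=
    MatContDiffAt.comp (x := (x, u)) (S.matContDiffAt_coupledInertia hx) hfst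
  have hq : ∀ i, ContDiffAt ℝ 1 (fun p : State n × Input N => S.qdot p.1 i) (x, u) := fun i =>
    ContDiffAt.comp (g := fun y => S.qdot y i) (x, u) (S.contDiffAt_qdot hx i) hfst
  have hv : ContDiffAt ℝ 1 (fun p : State n × Input N => (S.coupledInertia p.1)⁻¹ *ᵥ
      (S.grasp p.1 *ᵥ p.2 - S.coupledCoriolis p.1 *ᵥ State.twist p.1 - S.coupledGravity p.1))
      (x, u) :=
    (hin.inv (S.det_coupledInertia_ne_zero hx)).mulVec
      (((hgrasp.mulVec hsnd).sub (hcor.mulVec htw)).sub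
        (contDiffAt_const.add (hgrasp.mulVec hgrav)))
  have hp : ContDiffAt ℝ 1 (fun p : State n × Input N =>
      objRepJac (State.euler p.1) *ᵥ State.twist p.1) (x, u) :=
    (matContDiffAt_objRepJac heu hx.1).mulVec htw
  refine contDiffAt_pi.2 fun k => ?_
  rcases k with k | k | k
  · exact contDiffAt_pi.1 hp k
  · exact contDiffAt_pi.1 hv k
  · exact contDiffAt_pi.1 (hq k.1) k.2

end CoopSystem

end Coupled

end CoopNMPC

namespace CoopNMPC

namespace MPCData

variable {N : ℕ} {n : Fin N → ℕ} {Z : ℕ} {S : CoopSystem n Z} {D : MPCData n}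

/-! ### Costs and error dynamics -/

theorem continuous_runCost :
    Continuous fun p : State n × Input N => D.runCost p.1 p.2 := by
  unfold runCost
  exact (continuous_fst.dotProduct (continuous_const.matrix_mulVec continuous_fst)).add
    (continuous_snd.dotProduct (continuous_const.matrix_mulVec continuous_snd))

theorem differentiable_termCost : Differentiable ℝ D.termCost := by
  unfold termCost dotProduct Matrix.mulVec dotProduct
  fun_prop

theorem termCost_nonneg (hP : D.P.PosDef) (e : State n) : 0 ≤ D.termCost e := by
  have h : 0 ≤ e ⬝ᵥ (D.P *ᵥ e) := by simpa using hP.posSemidef.dotProduct_mulVec_nonneg e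
  exact h

/-- For diagonal `Q` the state cost is a sum of nonnegative terms, one per component, so each is
dominated by the whole. This turns a bound on the cost into bounds on individual errors. -/
theorem mul_sq_le_runCost (hQdiag : D.Q.IsDiag) (hQ : D.Q.PosSemidef) (hR : D.R.PosDef)
    (e : State n) (u : Input N) (k : StateIdx n) : D.Q k k * e k ^ 2 ≤ D.runCost e u := by
  have h1 : 0 ≤ u ⬝ᵥ (D.R *ᵥ u) := by simpa using hR.posSemidef.dotProduct_mulVec_nonneg u
  have h2 : e ⬝ᵥ (D.Q *ᵥ e) = ∑ a, D.Q a a * e a ^ 2 := by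
    refine Finset.sum_congr rfl fun a _ => ?_
    rw [Matrix.mulVec, dotProduct, Finset.sum_eq_single a (fun b _ hb => by
      rw [hQdiag hb.symm, zero_mul]) (by simp)]
    ring
  have h3 : D.Q k k * e k ^ 2 ≤ ∑ a, D.Q a a * e a ^ 2 :=
    Finset.single_le_sum (f := fun a => D.Q a a * e a ^ 2)
      (fun a _ => mul_nonneg hQ.diag_nonneg (sq_nonneg _)) (Finset.mem_univ k)
  unfold runCost
  linarith

theorem runCost_nonneg (hQ : D.Q.PosSemidef) (hR : D.R.PosDef) (e : State n) (u : Input N) :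
    0 ≤ D.runCost e u := by
  have h1 : 0 ≤ u ⬝ᵥ (D.R *ᵥ u) := by simpa using hR.posSemidef.dotProduct_mulVec_nonneg u
  have h2 : 0 ≤ e ⬝ᵥ (D.Q *ᵥ e) := by simpa using hQ.dotProduct_mulVec_nonneg e
  exact add_nonneg h2 h1

theorem contDiffAt_errDyn {e : State n} (he : e + D.target ∈ S.regular) (u : Input N) :
    ContDiffAt ℝ 1 (fun p : State n × Input N => D.errDyn S p.1 p.2) (e, u) := by
  have h : ContDiffAt ℝ 1 (fun p : State n × Input N => (p.1 + D.target, p.2)) (e, u) :=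
    (contDiffAt_fst.add contDiffAt_const).prodMk contDiffAt_snd
  have h' : ContDiffAt ℝ 1 (fun p : State n × Input N => S.dyn p.1 p.2)
      ((fun p : State n × Input N => (p.1 + D.target, p.2)) (e, u)) := S.contDiffAt_dyn he u
  exact h'.comp (e, u) h

theorem IsFeasible.piecewise_runCost {e₀ : State n} {u : ℝ → Input N} {e : ℝ → State n}
    (h : D.IsFeasible S e₀ u e) :
    PiecewiseContinuousOn (fun s => D.runCost (e s) (u s)) 0 D.Tp :=
  h.piecewise.comp₂ h.solution.1 continuous_runCost

/-! ### Recursive feasibility and decrease of the cost -/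

/-- Shifting a feasible prediction by one sampling period and appending the terminal controller
gives a feasible prediction, and its cost is smaller by at least the running cost accumulated over
the sampling period. -/
theorem IsFeasible.exists_shift (hhs : 0 < D.hs) (hTp : D.hs < D.Tp)
    (hEf_sub : D.terminal ⊆ D.errSet S) (hterm : D.TerminalCondition S) {e₀ : State n}
    {u : ℝ → Input N} {e : ℝ → State n} (h : D.IsFeasible S e₀ u e) :
    ∃ u' e', D.IsFeasible S (e D.hs) u' e' ∧
      D.cost u' e' + ∫ s in (0 : ℝ)..D.hs, D.runCost (e s) (u s) ≤ D.cost u e := by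
  obtain ⟨v, w, hv, hw, hw0, hvw⟩ := hterm _ h.terminal_mem
  -- `T` is the junction of the two pieces. At `T` the input takes the old value, while both
  -- formulas for the state agree there because `w` starts at `e D.Tp`.
  set T := D.Tp - D.hs with hT
  have hT0 : 0 < T := by linarith
  have hTle : T ≤ D.Tp := by linarith
  set u' : ℝ → Input N := fun s => if s ≤ T then u (s + D.hs) else v (s + -T) with hu'
  set e' : ℝ → State n := fun s => if s ≤ T then e (s + D.hs) else w (s + -T) with he'
  have hu'₁ : ∀ s ≤ T, u' s = u (s + D.hs) := fun s hs => if_pos hs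
  have he'₁ : ∀ s ≤ T, e' s = e (s + D.hs) := fun s hs => if_pos hs
  have hu'₂ : ∀ s, T < s → u' s = v (s + -T) := fun s hs => if_neg (not_le.2 hs)
  have he'₂ : ∀ s, T ≤ s → e' s = w (s + -T) := by
    intro s hs
    rcases hs.eq_or_lt with rfl | hs
    · rw [he'₁ _ le_rfl, add_neg_cancel, hw0, hT, sub_add_cancel]
    · exact if_neg (not_le.2 hs)
  have hpw : PiecewiseContinuousOn u' 0 D.Tp := by
    refine PiecewiseContinuousOn.trans (b := T) ?_ ?_
    · have := (h.piecewise.mono hhs.le le_rfl).comp_add_const D.hs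
      rw [sub_self] at this
      exact this.congr fun s hs => hu'₁ s hs.2.le
    · have := hv.comp_add_const (-T)
      rw [show (0 : ℝ) - -T = T by ring, show D.hs - -T = D.Tp by rw [hT]; ring] at this
      exact this.congr fun s hs => hu'₂ s hs.1
  have hsol : IsSolution (D.errDyn S) u' e' 0 D.Tp := by
    refine IsSolution.trans hT0.le hTle ?_ ?_
    · have := (h.solution.mono hhs.le le_rfl).comp_add_const D.hs
      rw [sub_self] at this
      exact this.congr (fun s hs => he'₁ s hs.2) fun s hs => hu'₁ s hs.2.le
    · have := hw.comp_add_const (-T)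
      rw [show (0 : ℝ) - -T = T by ring, show D.hs - -T = D.Tp by rw [hT]; ring] at this
      exact this.congr (fun s hs => he'₂ s hs.1) fun s hs => hu'₂ s hs.1
  have hcf : ∀ s ∈ Icc T D.Tp, s + -T ∈ Icc 0 D.hs := fun s hs =>
    ⟨by linarith [hs.1], by linarith [hs.2]⟩
  have hsh : ∀ s ∈ Icc 0 T, s + D.hs ∈ Icc 0 D.Tp := fun s hs =>
    ⟨by linarith [hs.1], by linarith [hs.2]⟩
  have hend : e' D.Tp = w D.hs := by rw [he'₂ _ hTle, hT]; congr 1; ring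
  have hfeas : D.IsFeasible S (e D.hs) u' e' := by
    refine ⟨hpw, hsol, ?_, fun s hs => ?_, fun s hs => ?_, ?_⟩
    · rw [he'₁ 0 hT0.le, zero_add]
    · rcases le_or_gt s T with hsT | hsT
      · rw [he'₁ s hsT]; exact h.state_mem _ (hsh s ⟨hs.1, hsT⟩)
      · rw [he'₂ s hsT.le]; exact hEf_sub (hvw _ (hcf s ⟨hsT.le, hs.2⟩)).2.1
    · rcases le_or_gt s T with hsT | hsT
      · rw [he'₁ s hsT, hu'₁ s hsT]; exact h.input_mem _ (hsh s ⟨hs.1, hsT⟩)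
      · rw [he'₂ s hsT.le, hu'₂ s hsT]; exact (hvw _ (hcf s ⟨hsT.le, hs.2⟩)).1
    · rw [hend]; exact (hvw _ ⟨hhs.le, le_rfl⟩).2.1
  refine ⟨u', e', hfeas, ?_⟩
  -- The decrease of the terminal cost along the appended piece pays for the running cost of that
  -- piece.
  have hdiss := hw.add_integral_le hhs.le D.differentiable_termCost
    (hv.comp₂ hw.1 D.continuous_runCost) fun s hs => (hvw s hs).2.2
  have hI := h.piecewise_runCost.intervalIntegrable (by linarith)
  have hI' := hfeas.piecewise_runCost.intervalIntegrable (by linarith)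
  have hsub : ∀ {φ : ℝ → ℝ} {a b : ℝ}, IntervalIntegrable φ MeasureTheory.volume 0 D.Tp →
      0 ≤ a → a ≤ b → b ≤ D.Tp → IntervalIntegrable φ MeasureTheory.volume a b :=
    fun hφ ha hab hb => hφ.mono_set (by
      rw [uIcc_of_le hab, uIcc_of_le (by linarith)]; exact Icc_subset_Icc ha hb)
  have hsplit := intervalIntegral.integral_add_adjacent_intervals
    (hsub hI le_rfl hhs.le hTp.le) (hsub hI hhs.le hTp.le le_rfl)
  have hsplit' := intervalIntegral.integral_add_adjacent_intervals
    (hsub hI' le_rfl hT0.le hTle) (hsub hI' hT0.le hTle le_rfl)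
  have hfirst : ∫ s in (0 : ℝ)..T, D.runCost (e' s) (u' s) =
      ∫ s in D.hs..D.Tp, D.runCost (e s) (u s) := by
    have h1 := intervalIntegral.integral_comp_add_right (a := 0) (b := T)
      (fun s => D.runCost (e s) (u s)) D.hs
    rw [zero_add, hT, sub_add_cancel] at h1
    rw [← h1]
    refine intervalIntegral.integral_congr fun s hs => ?_
    rw [uIcc_of_le hT0.le] at hs
    simp only [he'₁ s hs.2, hu'₁ s hs.2]
  have hsecond : ∫ s in T..D.Tp, D.runCost (e' s) (u' s) =
      ∫ s in (0 : ℝ)..D.hs, D.runCost (w s) (v s) := by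
    have h1 := intervalIntegral.integral_comp_add_right (a := T) (b := D.Tp)
      (fun s => D.runCost (w s) (v s)) (-T)
    rw [add_neg_cancel, show D.Tp + -T = D.hs by rw [hT]; ring] at h1
    rw [← h1]
    -- Equality of the integrands is needed only on the half-open interval `(T, D.Tp]`. At `T` the
    -- input is still the old one.
    refine intervalIntegral.integral_congr_ae (Eventually.of_forall fun s hs => ?_)
    rw [uIoc_of_le hTle] at hs
    simp only [he'₂ s hs.1.le, hu'₂ s hs.1]
  rw [hw0] at hdiss
  unfold cost
  rw [hend, ← hsplit, ← hsplit', hfirst, hsecond]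
  linarith

/-- On a sampling interval the closed loop follows the prediction of the applied input. -/
theorem IsClosedLoop.eqOn_prediction (hTp : D.hs < D.Tp) {e₀ : State n}
    {e : ℝ → State n} {u : ℝ → Input N} (hcl : D.IsClosedLoop S e₀ e u) {j : ℕ}
    {v : ℝ → Input N} {w : ℝ → State n} (h : D.IsFeasible S (e (j * D.hs)) v w)
    (hv : ∀ s ∈ Ico 0 D.hs, u (j * D.hs + s) = v s) :
    ∀ s ∈ Icc 0 D.hs, e (s + j * D.hs) = w s := by
  have h1 := (hcl.solution j).comp_add_const (j * D.hs)
  rw [sub_self, show ((j : ℝ) + 1) * D.hs - j * D.hs = D.hs by ring] at h1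
  have h2 : IsSolution (D.errDyn S) v (fun s => e (s + j * D.hs)) 0 D.hs :=
    h1.congr (fun s _ => rfl) fun s hs => by
      simpa only [add_comm] using (hv s (Ioo_subset_Ico_self hs)).symm
  have h3 := h.solution.mono le_rfl hTp.le
  -- The Lipschitz condition is checked along the prediction, which is admissible and therefore
  -- regular. Nothing of the kind is known yet about the closed loop.
  refine fun s hs => (h3.eqOn h2 (fun t ht => h.piecewise.2.1 t ⟨ht.1, ht.2.trans hTp⟩) (fun t ht l => ?_)
    ?_ hs).symm
  · exact (contDiffAt_errDyn
      (S.stateSet_subset_regular (h.state_mem t ⟨ht.1, ht.2.trans hTp.le⟩)) l).exists_lipschitzOnWith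
  · rw [h.initial, zero_add]

variable (hhs : 0 < D.hs) (hTp : D.hs < D.Tp)
  (hEf_sub : D.terminal ⊆ D.errSet S) (hterm : D.TerminalCondition S)
  {e₀ : State n} (hfeas : D.Feasible S e₀) {e : ℝ → State n} {u : ℝ → Input N}
  (hcl : D.IsClosedLoop S e₀ e u)

include hhs hTp hEf_sub hterm hfeas hcl

/-- Recursive feasibility: the optimal control problem is feasible at every sampling time. -/
theorem IsClosedLoop.feasible (j : ℕ) : D.Feasible S (e (j * D.hs)) := by
  induction j with
  | zero => simpa [hcl.initial] using hfeas
  | succ j ih =>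
    obtain ⟨v, ⟨w, hw, -⟩, hv⟩ := hcl.law j ih
    obtain ⟨u', e', h', -⟩ := hw.exists_shift hhs hTp hEf_sub hterm
    have h1 := hcl.eqOn_prediction hTp hw hv _ (right_mem_Icc.2 hhs.le)
    refine ⟨u', e', ?_⟩
    rwa [← h1, show D.hs + j * D.hs = ((j + 1 : ℕ) : ℝ) * D.hs by push_cast; ring] at h'

/-- Every time belongs to one interval `[t_j, t_{j+1})`, on which state and input agree with an
admissible prediction. The half-open form attributes the input at `t_j` to the newly computed
optimum. -/
theorem IsClosedLoop.mem (t : ℝ) (ht : 0 ≤ t) :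
    e t ∈ D.errSet S ∧ u t ∈ D.errInputSet S (e t) := by
  set j := ⌊t / D.hs⌋₊ with hj
  have hj1 : j * D.hs ≤ t := by
    have := Nat.floor_le (div_nonneg ht hhs.le)
    rwa [le_div_iff₀ hhs] at this
  have hj2 : t < (j + 1) * D.hs := by
    have := Nat.lt_floor_add_one (t / D.hs)
    rwa [div_lt_iff₀ hhs] at this
  obtain ⟨v, ⟨w, hw, -⟩, hv⟩ :=
    hcl.law j (hcl.feasible hhs hTp hEf_sub hterm hfeas j)
  have hs : t - j * D.hs ∈ Ico 0 D.hs := ⟨by linarith, by linarith⟩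
  have h1 := hcl.eqOn_prediction hTp hw hv _ (Ico_subset_Icc_self hs)
  have h2 := hv _ hs
  simp only [sub_add_cancel, add_sub_cancel] at h1 h2
  rw [h1, h2]
  have hs' : t - j * D.hs ∈ Icc 0 D.Tp := ⟨hs.1, by linarith [hs.2]⟩
  exact ⟨hw.state_mem _ hs', hw.input_mem _ hs'⟩

/-- The weighted squared error has vanishing integral over the sampling intervals. -/
theorem IsClosedLoop.exists_integral_sq_le (hQdiag : D.Q.IsDiag) (hQ : D.Q.PosSemidef)
    (hR : D.R.PosDef) (hP : D.P.PosDef) : ∃ c : ℕ → ℝ, Tendsto c atTop (𝓝 0) ∧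
      ∀ (j : ℕ) k, D.Q k k * ∫ s in (0 : ℝ)..D.hs, e (s + j * D.hs) k ^ 2 ≤ c j := by
  choose v hopt hv using fun j => hcl.law j (hcl.feasible hhs hTp hEf_sub hterm hfeas j)
  choose w hw hmin using hopt
  have heq := fun j => hcl.eqOn_prediction hTp (hw j) (hv j)
  set J : ℕ → ℝ := fun j => D.cost (v j) (w j) with hJ
  set I : ℕ → ℝ := fun j => ∫ s in (0 : ℝ)..D.hs, D.runCost (w j s) (v j s) with hI
  have hI0 : ∀ j, 0 ≤ I j := fun j =>
    intervalIntegral.integral_nonneg hhs.le fun s _ => runCost_nonneg hQ hR _ _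
  have hJ0 : ∀ j, 0 ≤ J j := fun j => add_nonneg (termCost_nonneg hP _)
    (intervalIntegral.integral_nonneg (by linarith) fun s _ => runCost_nonneg hQ hR _ _)
  -- The shifted prediction competes with the optimum at the next sampling time.
  have hstep : ∀ j, I j ≤ J j - J (j + 1) := fun j => by
    obtain ⟨u', e', h', hcost⟩ := (hw j).exists_shift hhs hTp hEf_sub hterm
    rw [← heq j _ (right_mem_Icc.2 hhs.le),
      show D.hs + j * D.hs = ((j + 1 : ℕ) : ℝ) * D.hs by push_cast; ring] at h'
    linarith [hmin (j + 1) u' e' h']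
  have hanti : Antitone J := antitone_nat_of_succ_le fun j => by linarith [hstep j, hI0 j]
  have hlim := tendsto_atTop_ciInf hanti ⟨0, by rintro _ ⟨j, rfl⟩; exact hJ0 j⟩
  -- The optimal costs decrease and are bounded below, so they converge and their increments vanish.
  refine ⟨fun j => J j - J (j + 1), ?_, fun j k => le_trans ?_ (hstep j)⟩
  · simpa using hlim.sub (hlim.comp (tendsto_add_atTop_nat 1))
  · have h1 : ∫ s in (0 : ℝ)..D.hs, e (s + j * D.hs) k ^ 2 =
        ∫ s in (0 : ℝ)..D.hs, w j s k ^ 2 :=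
      intervalIntegral.integral_congr fun s hs => by
        rw [uIcc_of_le hhs.le] at hs
        simp only [heq j s hs]
    rw [h1, ← intervalIntegral.integral_const_mul]
    have hc : ContinuousOn (fun s => w j s k) (Icc 0 D.hs) :=
      (continuous_apply k).comp_continuousOn
        ((hw j).solution.1.mono (Icc_subset_Icc_right hTp.le))
    refine intervalIntegral.integral_mono_on hhs.le ?_ ?_ fun s _ =>
      mul_sq_le_runCost hQdiag hQ hR _ _ k
    · exact ContinuousOn.intervalIntegrable (by
        rw [uIcc_of_le hhs.le]; exact continuousOn_const.mul (hc.pow 2))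
    · exact ((hw j).piecewise_runCost.mono le_rfl hTp.le).intervalIntegrable hhs.le

end MPCData

end CoopNMPC

namespace CoopNMPC

/-! ### Bounds -/

theorem abs_le_l2norm {ι : Type*} [Fintype ι] (v : ι → ℝ) (k : ι) : |v k| ≤ l2norm v :=
  PiLp.norm_apply_le (WithLp.toLp 2 v) k

theorem l2norm_le_sum {ι : Type*} [Fintype ι] (v : ι → ℝ) : l2norm v ≤ ∑ k, |v k| := by
  rw [l2norm, EuclideanSpace.norm_eq]
  refine Real.sqrt_le_iff.2 ⟨Finset.sum_nonneg fun _ _ => abs_nonneg _, ?_⟩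
  exact Finset.sum_sq_le_sq_sum_of_nonneg fun k _ => abs_nonneg (v k)

theorem isBigO_mulVec {α ι κ : Type*} [Fintype κ] {l : Filter α} {B : α → Matrix ι κ ℝ}
    {w : α → κ → ℝ} {g : α → ℝ} (hB : ∀ a b, (fun t => B t a b) =O[l] fun _ => (1 : ℝ))
    (hw : ∀ b, (fun t => w t b) =O[l] g) (a : ι) :
    (fun t => (B t *ᵥ w t) a) =O[l] g := by
  simp only [Matrix.mulVec, dotProduct]
  refine Asymptotics.IsBigO.fun_sum fun b _ => ?_
  simpa using (hB a b).mul (hw b)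

theorem MatContDiffAt.isBigO_one {α ι κ E : Type*} [NormedAddCommGroup E] [NormedSpace ℝ E]
    {l : Filter α} {B : E → Matrix ι κ ℝ} {q : α → E} {q₀ : E} (hB : MatContDiffAt 1 B q₀)
    (hq : Tendsto q l (𝓝 q₀)) (a : ι) (b : κ) :
    (fun t => B (q t) a b) =O[l] fun _ => (1 : ℝ) :=
  ((hB a b).continuousAt.tendsto.comp hq).isBigO_one ℝ

/-- The smallest singular value of `Jᵀ` is bounded below in terms of the pseudo-inverse. -/
theorem Agent.one_le_mul_sigmaMin {m : ℕ} (A : Agent m) {q : Cfg m} (hq : q ∈ A.nonsing) :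
    1 ≤ (∑ k, ∑ c, |A.pinv q c k|) * sigmaMin (A.jac q)ᵀ := by
  set C := ∑ k, ∑ c, |A.pinv q c k| with hC
  have hC0 : 0 ≤ C := Finset.sum_nonneg fun _ _ => Finset.sum_nonneg fun _ _ => abs_nonneg _
  have key : ∀ x : Six → ℝ, l2norm x = 1 → 1 ≤ C * l2norm ((A.jac q)ᵀ *ᵥ x) := by
    intro x hx
    -- Transposing `J J⁺ = 1` shows that `(J⁺)ᵀ` is a left inverse of `Jᵀ`, so its size limits how
    -- far `Jᵀ` can shrink a unit vector.
    have h1 : (A.pinv q)ᵀ *ᵥ ((A.jac q)ᵀ *ᵥ x) = x := by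
      rw [Matrix.mulVec_mulVec, ← Matrix.transpose_mul, A.jac_mul_pinv hq, Matrix.transpose_one,
        Matrix.one_mulVec]
    set y := (A.jac q)ᵀ *ᵥ x with hy
    calc (1 : ℝ) = l2norm ((A.pinv q)ᵀ *ᵥ y) := by rw [h1, hx]
      _ ≤ ∑ k, |((A.pinv q)ᵀ *ᵥ y) k| := l2norm_le_sum _
      _ ≤ ∑ k, ∑ c, |A.pinv q c k| * l2norm y := by
          refine Finset.sum_le_sum fun k _ => ?_
          simp only [Matrix.mulVec, dotProduct]
          refine (Finset.abs_sum_le_sum_abs (fun c => (A.pinv q)ᵀ k c * y c) Finset.univ).trans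
            (Finset.sum_le_sum fun c _ => ?_)
          rw [abs_mul, Matrix.transpose_apply]
          exact mul_le_mul_of_nonneg_left (abs_le_l2norm y c) (abs_nonneg _)
      _ = C * l2norm y := by simp only [hC, Finset.sum_mul]
  -- A unit vector shows both that `C` is positive and that the infimum defining `sigmaMin` is over
  -- a nonempty set.
  have hunit : l2norm (Pi.single (Sum.inl 0) 1 : Six → ℝ) = 1 := by
    simp [l2norm]
  have hCpos : 0 < C := by
    rcases hC0.eq_or_lt with h | h
    · have := key _ hunit
      rw [← h, zero_mul] at this
      linarith
    · exact h
  have h2 : C⁻¹ ≤ sigmaMin (A.jac q)ᵀ := by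
    refine le_csInf ⟨_, _, hunit, rfl⟩ ?_
    rintro r ⟨x, hx, rfl⟩
    rw [inv_le_iff_one_le_mul₀' hCpos]
    exact key x hx
  rwa [inv_le_iff_one_le_mul₀' hCpos] at h2

/-- The object twist is recovered from the joint velocity of any agent. -/
theorem Agent.twist_eq {m : ℕ} (A : Agent m) {q : Cfg m} (hq : q ∈ A.nonsing) (v : Six → ℝ) :
    v = ((A.objJac q)⁻¹ * A.jac q) *ᵥ A.jointVel q v := by
  rw [← Matrix.mulVec_mulVec, Agent.jointVel, Matrix.mulVec_mulVec (M := A.jac q),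
    A.jac_mul_pinv hq, Matrix.one_mulVec, Matrix.mulVec_mulVec,
    Matrix.nonsing_inv_mul _ (by rw [A.det_objJac]; exact isUnit_one), Matrix.one_mulVec]

/-- The only unbounded entries carry a factor `1 / cos (η 1)`, which is at most `1 / cos θ` on the
allowed pitch range. That number is at least `1`, so it also covers the remaining entries. -/
theorem abs_objRepJac_le {η : Fin 3 → ℝ} {θ : ℝ} (hθ : θ < Real.pi / 2)
    (hη : η 1 ∈ Icc (-θ) θ) (a b : Six) : |objRepJac η a b| ≤ (Real.cos θ)⁻¹ := by
  have hθ0 : 0 ≤ θ := by linarith [hη.1, hη.2]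
  have hc : 0 < Real.cos θ := Real.cos_pos_of_mem_Ioo ⟨by linarith, hθ⟩
  have hcle : Real.cos θ ≤ Real.cos (η 1) := by
    rw [← Real.cos_abs (η 1)]
    exact Real.cos_le_cos_of_nonneg_of_le_pi (abs_nonneg _) (by linarith [Real.pi_pos])
      (abs_le.2 hη)
  have h1 : 1 ≤ (Real.cos θ)⁻¹ := (one_le_inv₀ hc).2 (Real.cos_le_one _)
  have h0 : 0 ≤ (Real.cos θ)⁻¹ := by positivity
  have hinv : |(Real.cos (η 1))⁻¹| ≤ (Real.cos θ)⁻¹ := by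
    rw [abs_of_nonneg (inv_nonneg.2 (hc.le.trans hcle))]
    exact inv_anti₀ hc hcle
  have hdiv : ∀ y, |y| ≤ 1 → |y / Real.cos (η 1)| ≤ (Real.cos θ)⁻¹ := fun y hy => by
    rw [div_eq_mul_inv, abs_mul]
    exact (mul_le_of_le_one_left (abs_nonneg _) hy).trans hinv
  have htan : ∀ y, |y| ≤ 1 → |y * Real.tan (η 1)| ≤ (Real.cos θ)⁻¹ := fun y hy => by
    rw [Real.tan_eq_sin_div_cos, ← mul_div_assoc]
    refine hdiv _ ?_
    rw [abs_mul]
    exact mul_le_one₀ hy (abs_nonneg _) (Real.abs_sin_le_one _)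
  have hone : |(1 : ℝ)| ≤ (Real.cos θ)⁻¹ := by rwa [abs_one]
  have hzero : |(0 : ℝ)| ≤ (Real.cos θ)⁻¹ := by rwa [abs_zero]
  rcases a with a | a <;> rcases b with b | b
  · simp only [objRepJac, Matrix.fromBlocks_apply₁₁, Matrix.one_apply]
    split_ifs
    · exact hone
    · exact hzero
  · exact hzero
  · exact hzero
  · fin_cases a <;> fin_cases b
    · exact hone
    · exact htan _ (Real.abs_sin_le_one _)
    · exact htan _ (Real.abs_cos_le_one _)
    · exact hzero
    · exact (Real.abs_cos_le_one _).trans h1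
    · exact (abs_neg (Real.sin _)).le.trans ((Real.abs_sin_le_one _).trans h1)
    · exact hzero
    · exact hdiv _ (Real.abs_sin_le_one _)
    · exact hdiv _ (Real.abs_cos_le_one _)

namespace MPCData

variable {N : ℕ} {n : Fin N → ℕ} {Z : ℕ} {S : CoopSystem n Z} {D : MPCData n}

/-! ### Convergence of the closed loop -/

theorem IsClosedLoop.isSolution (hhs : 0 < D.hs) {e₀ : State n} {e : ℝ → State n}
    {u : ℝ → Input N} (hcl : D.IsClosedLoop S e₀ e u) {a b : ℝ} (ha : 0 ≤ a) :
    IsSolution (D.errDyn S) u e a b := by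
  have h : ∀ j : ℕ, IsSolution (D.errDyn S) u e 0 ((j + 1) * D.hs) := fun j => by
    induction j with
    | zero => simpa using hcl.solution 0
    | succ j ih =>
      have h1 := hcl.solution (j + 1)
      push_cast at h1 ⊢
      exact ih.trans (by positivity) (by nlinarith) h1
  obtain ⟨j, hj⟩ := exists_nat_gt (b / D.hs)
  rw [div_lt_iff₀ hhs] at hj
  exact (h j).mono ha (by nlinarith)

/-- Stated for a single component, because bounds on the joint, pose and twist rates become
available one after the other. -/
theorem abs_sub_le_of_isSolution {e : ℝ → State n} {u : ℝ → Input N}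
    (hsol : ∀ a b, 0 ≤ a → IsSolution (D.errDyn S) u e a b) {T₀ L : ℝ} (hT₀ : 0 ≤ T₀)
    {k : StateIdx n} (hL : ∀ t, T₀ ≤ t → |D.errDyn S (e t) (u t) k| ≤ L) (s t : ℝ)
    (hs : T₀ ≤ s) (ht : T₀ ≤ t) : |e s k - e t k| ≤ L * |s - t| := by
  wlog hst : t ≤ s generalizing s t
  · rw [abs_sub_comm, abs_sub_comm s]
    exact this t s ht hs (le_of_not_ge hst)
  obtain ⟨hc, F, hF, hd⟩ := hsol t s (hT₀.trans ht)
  rw [abs_of_nonneg (sub_nonneg.2 hst)]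
  refine abs_sub_le_mul_of_hasDerivWithinAt (φ := fun r => e r k) hF hst
    ((continuous_apply k).comp_continuousOn hc) fun r hr => ⟨_, hL r (ht.trans hr.1.1.le), ?_⟩
  exact hasDerivWithinAt_pi.1 (hd r ⟨Ioo_subset_Icc_self hr.1, hr.2⟩) k

theorem State.joint_tendsto {α : Type*} {l : Filter α} {x : α → State n} {x₀ : State n}
    (i : Fin N) (h : ∀ a, Tendsto (fun t => x t (Sum.inr (Sum.inr ⟨i, a⟩))) l
      (𝓝 (x₀ (Sum.inr (Sum.inr ⟨i, a⟩))))) :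
    Tendsto (fun t => State.joint (x t) i) l (𝓝 (State.joint x₀ i)) :=
  tendsto_pi_nhds.2 h

/-- A compact box of errors: pose and joint errors at most `r`, twist
errors at most `C`. -/
def errBox (n : Fin N → ℕ) (r C : ℝ) : Set (State n) :=
  Set.univ.pi fun k => Sum.elim (fun _ => Icc (-r) r)
    (Sum.elim (fun _ => Icc (-C) C) fun _ => Icc (-r) r) k

theorem isCompact_errBox (r C : ℝ) : IsCompact (errBox n r C) := by
  refine isCompact_univ_pi fun k => ?_
  rcases k with k | k | k <;> exact isCompact_Icc

/-- Regularity does not involve the twist, so one `r` serves all twist bounds `C`. -/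
theorem exists_errBox_regular (h : D.target ∈ S.regular) :
    ∃ r > 0, ∀ C, ∀ e ∈ errBox n r C, e + D.target ∈ S.regular := by
  obtain ⟨ε, hε, hball⟩ := Metric.isOpen_iff.1 S.isOpen_regular _ h
  refine ⟨ε / 2, by positivity, fun C e he => ?_⟩
  have h1 : State.mk (State.pose e) 0 (State.joint e) + D.target ∈ S.regular := by
    refine hball ?_
    rw [Metric.mem_ball, dist_eq_norm, add_sub_cancel_right]
    refine lt_of_le_of_lt ((pi_norm_le_iff_of_nonneg (by positivity)).2 fun k => ?_)
      (half_lt_self hε)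
    have hk := he k (mem_univ k)
    rcases k with k | k | k
    · exact abs_le.2 hk
    · simp only [State.mk, Sum.elim_inr, Sum.elim_inl, Pi.zero_apply, norm_zero]
      positivity
    · exact abs_le.2 hk
  exact h1

theorem continuousOn_errDyn {s : Set (State n)} (hs : ∀ e ∈ s, e + D.target ∈ S.regular)
    (s' : Set (Input N)) :
    ContinuousOn (fun p : State n × Input N => D.errDyn S p.1 p.2) (s ×ˢ s') := fun p hp =>
  (contDiffAt_errDyn (hs p.1 hp.1) p.2).continuousAt.continuousWithinAt

section Convergence

variable {e : ℝ → State n} {u : ℝ → Input N}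

/-- Boundedness of the inputs once the joints converge. -/
theorem isBigO_input (hmem : ∀ t, 0 ≤ t → e t ∈ D.errSet S ∧ u t ∈ D.errInputSet S (e t))
    (htarget : D.target ∈ S.regular)
    (hq : ∀ i, Tendsto (fun t => State.joint (e t + D.target) i) atTop
      (𝓝 (State.joint D.target i))) (c : InputIdx N) :
    (fun t => u t c) =O[atTop] fun _ => (1 : ℝ) := by
  obtain ⟨k, i⟩ := c
  have hpinv : ∀ c k, (fun t => |(S.agent i).pinv (State.joint (e t + D.target) i) c k|)
      =O[atTop] fun _ => (1 : ℝ) := fun c k =>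
    (((S.agent i).matContDiffAt_pinv contDiffAt_id (htarget.2 i)).isBigO_one (hq i) c k).norm_left
  have hsum : (fun t => (S.agent i).torqueBound *
      ∑ k, ∑ c, |(S.agent i).pinv (State.joint (e t + D.target) i) c k|)
      =O[atTop] fun _ => (1 : ℝ) :=
    (Asymptotics.IsBigO.fun_sum fun k _ => Asymptotics.IsBigO.fun_sum fun c _ =>
      hpinv c k).const_mul_left _
  refine (Asymptotics.IsBigO.of_bound 1 ?_).trans hsum
  filter_upwards [eventually_ge_atTop 0] with t ht
  obtain ⟨h1, h2⟩ := hmem t ht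
  -- The input bound `τ̄ / σ_min` is thus at most `τ̄ * C`, and `C` stays bounded since the joints
  -- approach a nonsingular configuration.
  have h3 := (S.agent i).one_le_mul_sigmaMin (h1.2.2.1 i)
  set C := ∑ k, ∑ c, |(S.agent i).pinv (State.joint (e t + D.target) i) c k|
  have hC0 : 0 ≤ C := Finset.sum_nonneg fun _ _ => Finset.sum_nonneg fun _ _ => abs_nonneg _
  have hσ : 0 < sigmaMin ((S.agent i).jac (State.joint (e t + D.target) i))ᵀ := by
    by_contra! hcon
    nlinarith
  have h4 : |u t (k, i)| ≤ (S.agent i).torqueBound * C := by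
    refine (abs_le_l2norm (Input.wrench (u t) i) k).trans ((h2 i).trans ?_)
    rw [div_le_iff₀ hσ, mul_assoc]
    exact le_mul_of_one_le_right (S.agent i).torqueBound_pos.le h3
  rw [one_mul, Real.norm_eq_abs, Real.norm_eq_abs]
  exact h4.trans (le_abs_self _)

theorem exists_bound_of_isBigO_one {ι : Type*} [Finite ι] {w : ℝ → ι → ℝ}
    (h : ∀ k, (fun t => w t k) =O[atTop] fun _ => (1 : ℝ)) :
    ∃ C, ∀ᶠ t in atTop, ∀ k, |w t k| ≤ C := by
  cases nonempty_fintype ι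
  choose C hC using fun k => (h k).bound
  refine ⟨∑ k, |C k|, eventually_all.2 fun k => ?_⟩
  filter_upwards [hC k] with t ht
  simp only [Real.norm_eq_abs, abs_one, mul_one] at ht
  exact ht.trans ((le_abs_self _).trans
    (Finset.single_le_sum (f := fun k => |C k|) (fun _ _ => abs_nonneg _) (Finset.mem_univ k)))

/-- An admissible solution of the error dynamics whose pose and joint errors have vanishing
mean square over consecutive intervals tends to zero. -/
theorem tendsto_zero_of_integral (hN : 1 ≤ N) (hhs : 0 < D.hs)
    (hsol : ∀ a b, 0 ≤ a → IsSolution (D.errDyn S) u e a b)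
    (hmem : ∀ t, 0 ≤ t → e t ∈ D.errSet S ∧ u t ∈ D.errInputSet S (e t))
    (htarget : D.target ∈ S.regular)
    (hpose : ∀ k, ∃ c : ℕ → ℝ, Tendsto c atTop (𝓝 0) ∧
      ∀ j : ℕ, ∫ s in (0 : ℝ)..D.hs, e (s + j * D.hs) (Sum.inl k) ^ 2 ≤ c j)
    (hjoint : ∀ a, ∃ c : ℕ → ℝ, Tendsto c atTop (𝓝 0) ∧
      ∀ j : ℕ, ∫ s in (0 : ℝ)..D.hs, e (s + j * D.hs) (Sum.inr (Sum.inr a)) ^ 2 ≤ c j) :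
    Tendsto e atTop (𝓝 0) := by
  have hqdot : ∀ i a t, 0 ≤ t → |S.qdot (e t + D.target) i a| ≤ (S.agent i).velBound :=
    fun i a t ht => (abs_le_l2norm _ _).trans ((hmem t ht).1.2.1 i)
  have hq0 : ∀ a, Tendsto (fun t => e t (Sum.inr (Sum.inr a))) atTop (𝓝 0) := by
    rintro ⟨i, a⟩
    obtain ⟨c, hc, hint⟩ := hjoint ⟨i, a⟩
    exact tendsto_zero_of_integral_sq hhs
      (abs_sub_le_of_isSolution hsol le_rfl fun t ht => hqdot i a t ht) hc hint
  have hq : ∀ i, Tendsto (fun t => State.joint (e t + D.target) i) atTop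
      (𝓝 (State.joint D.target i)) := fun i => State.joint_tendsto i fun a => by
    simpa using (hq0 ⟨i, a⟩).add_const (D.target (Sum.inr (Sum.inr ⟨i, a⟩)))
  let i₀ : Fin N := ⟨0, hN⟩
  have hB := ((((S.agent i₀).matContDiffAt_objJac contDiffAt_id).inv (by
    simp [(S.agent i₀).det_objJac])).mul
      ((S.agent i₀).matContDiffAt_jac contDiffAt_id)).isBigO_one (hq i₀)
  have htw_eq : ∀ t, 0 ≤ t → State.twist (e t + D.target) = _ := fun t ht =>
    (S.agent i₀).twist_eq ((hmem t ht).1.2.2.1 i₀) (State.twist (e t + D.target))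
  -- The gauge `g` is left free: the constant `1` gives boundedness of the twist, and later a `g`
  -- tending to zero gives its convergence.
  have htwist : ∀ {g : ℝ → ℝ}, (∀ a, (fun t => S.qdot (e t + D.target) i₀ a) =O[atTop] g) →
      ∀ k, (fun t => State.twist (e t + D.target) k) =O[atTop] g := fun hg k => by
    refine (isBigO_mulVec hB hg k).congr' ?_ EventuallyEq.rfl
    filter_upwards [eventually_ge_atTop 0] with t ht
    exact (congrFun (htw_eq t ht) k).symm
  have htw_err : ∀ t k, e t (Sum.inr (Sum.inl k)) = State.twist (e t + D.target) k :=
    fun t k => by simp [State.twist, target, State.mk]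
  have htwO : ∀ k, (fun t => State.twist (e t + D.target) k) =O[atTop] fun _ => (1 : ℝ) :=
    htwist fun a => Asymptotics.IsBigO.of_bound (S.agent i₀).velBound (by
      filter_upwards [eventually_ge_atTop 0] with t ht
      simpa using hqdot i₀ a t ht)
  have hrep : ∀ a b, (fun t => objRepJac (State.euler (e t + D.target)) a b)
      =O[atTop] fun _ => (1 : ℝ) := fun a b =>
    Asymptotics.IsBigO.of_bound (Real.cos S.thetaBar)⁻¹ (by
      filter_upwards [eventually_ge_atTop 0] with t ht
      simpa using abs_objRepJac_le S.thetaBar_lt (hmem t ht).1.1 a b)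
  -- With bounded twist and pitch away from `±π/2`, the pose error is eventually Lipschitz.
  have hp0 : ∀ k, Tendsto (fun t => e t (Sum.inl k)) atTop (𝓝 0) := by
    obtain ⟨L, hL⟩ := exists_bound_of_isBigO_one (isBigO_mulVec hrep htwO)
    obtain ⟨T, hT⟩ := eventually_atTop.1 (hL.and (eventually_ge_atTop 0))
    intro k
    obtain ⟨c, hc, hint⟩ := hpose k
    exact tendsto_zero_of_integral_sq hhs (abs_sub_le_of_isSolution (k := Sum.inl k) hsol
      (hT T le_rfl).2 fun t ht => (hT t ht).1 k) hc hint
  obtain ⟨C, hC⟩ := exists_bound_of_isBigO_one htwO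
  obtain ⟨Cu, hCu⟩ := exists_bound_of_isBigO_one (isBigO_input hmem htarget hq)
  obtain ⟨r, hr, hbox⟩ := exists_errBox_regular htarget
  have hK := isCompact_errBox (n := n) r C
  -- The full vector field is bounded on a compact set of regular errors and bounded inputs that the
  -- closed loop eventually never leaves. This makes the whole error Lipschitz.
  obtain ⟨L, hL⟩ := (hK.prod (isCompact_closedBall (0 : Input N) |Cu|)).exists_bound_of_continuousOn
    (continuousOn_errDyn (hbox C) _)
  have hevent : ∀ᶠ t in atTop, e t ∈ errBox n r C ∧ u t ∈ Metric.closedBall (0 : Input N) |Cu| := by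
    filter_upwards [hC, hCu,
      eventually_all.2 fun k => (hp0 k).abs.eventually_le_const (by simpa using hr),
      eventually_all.2 fun a => (hq0 a).abs.eventually_le_const (by simpa using hr)]
      with t h1 h2 h3 h4
    refine ⟨fun k _ => ?_, ?_⟩
    · rcases k with k | k | k
      · exact abs_le.1 (h3 k)
      · exact abs_le.1 ((congrArg abs (htw_err t k)).le.trans (h1 k))
      · exact abs_le.1 (h4 k)
    · rw [mem_closedBall_zero_iff]
      exact (pi_norm_le_iff_of_nonneg (abs_nonneg _)).2 fun k => (h2 k).trans (le_abs_self _)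
  obtain ⟨T, hT⟩ := eventually_atTop.1 (hevent.and (eventually_ge_atTop 0))
  have hT0 : 0 ≤ T := (hT T le_rfl).2
  have hlip : ∀ k s t, T ≤ s → T ≤ t → |e s k - e t k| ≤ L * |s - t| := fun k =>
    abs_sub_le_of_isSolution hsol hT0 fun t ht =>
      (norm_le_pi_norm (D.errDyn S (e t) (u t)) k).trans (hL (e t, u t) (hT t ht).1)
  have hL0 : 0 ≤ L := (norm_nonneg _).trans (hL (e T, u T) (hT T le_rfl).1)
  have huc : UniformContinuousOn e (Ici T) := by
    refine (LipschitzOnWith.of_dist_le_mul (K := L.toNNReal) fun s hs t ht =>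
      (dist_pi_le_iff (by positivity)).2 fun k => ?_).uniformContinuousOn
    rw [Real.coe_toNNReal L hL0]
    exact hlip k s t hs ht
  -- The joint rate depends on the state alone, not on the possibly discontinuous input, so it is
  -- uniformly continuous in time and Barbalat's lemma applies.
  have hqdot0 : ∀ a, Tendsto (fun t => S.qdot (e t + D.target) i₀ a) atTop (𝓝 0) := fun a => by
    have hcq : ContinuousOn (fun y : State n => S.qdot (y + D.target) i₀ a) (errBox n r C) := by
      intro y hy
      have h1 := (contDiffAt_pi.1 (S.contDiffAt_qdot (hbox C y hy) i₀) a).continuousAt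
      exact (ContinuousAt.comp (f := fun y : State n => y + D.target) h1
        (continuous_id.add continuous_const).continuousAt).continuousWithinAt
    refine tendsto_zero_of_hasDerivWithinAt (T₀ := T) (hq0 ⟨i₀, a⟩) ?_ ?_
      ((hK.uniformContinuousOn_of_continuous hcq).comp huc fun t ht => (hT t ht).1.1)
    · exact (continuous_apply _).comp_continuousOn huc.continuousOn
    · intro b c hb _
      obtain ⟨-, F, hF, hd⟩ := hsol b c (hT0.trans hb)
      exact ⟨F, hF, fun t ht => hasDerivWithinAt_pi.1 (hd t ht) (Sum.inr (Sum.inr ⟨i₀, a⟩))⟩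
  have hv0 : ∀ k, Tendsto (fun t => e t (Sum.inr (Sum.inl k))) atTop (𝓝 0) := fun k => by
    simp only [htw_err]
    have hnorm : Tendsto (fun t => ∑ a, |S.qdot (e t + D.target) i₀ a|) atTop (𝓝 0) := by
      simpa using tendsto_finsetSum Finset.univ fun a _ => (hqdot0 a).abs
    refine (htwist (fun a => ?_) k).trans_tendsto hnorm
    refine Asymptotics.IsBigO.of_bound 1 (Eventually.of_forall fun t => ?_)
    rw [one_mul, Real.norm_eq_abs, Real.norm_eq_abs]
    exact (Finset.single_le_sum (f := fun a => |S.qdot (e t + D.target) i₀ a|)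
      (fun _ _ => abs_nonneg _) (Finset.mem_univ a)).trans (le_abs_self _)
  refine tendsto_pi_nhds.2 fun k => ?_
  rcases k with k | k | k
  · exact hp0 k
  · exact hv0 k
  · exact hq0 k

end Convergence

end MPCData

end CoopNMPC

/-! ### Assembly: recursive feasibility, admissibility and convergence. -/

theorem mainTheorem3 {N : ℕ} (hN : 1 ≤ N) (n : Fin N → ℕ) (Z : ℕ)
    (S : CoopNMPC.CoopSystem n Z) (D : CoopNMPC.MPCData n)
    -- sampling period and horizon
    (hhs : 0 < D.hs) (hTp : D.hs < D.Tp)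
    -- weights
    (hQdiag : D.Q.IsDiag) (hQ : D.Q.PosSemidef)
    (hQpose : ∀ k : CoopNMPC.Six, 0 < D.Q (Sum.inl k) (Sum.inl k))
    (hQjoint : ∀ a : (Σ i : Fin N, Fin (n i)), 0 < D.Q (Sum.inr (Sum.inr a)) (Sum.inr (Sum.inr a)))
    (hRdiag : D.R.IsDiag) (hR : D.R.PosDef)
    (hPdiag : D.P.IsDiag) (hP : D.P.PosDef)
    -- the collision-free space is connected
    (hconn : IsConnected {y : (∀ i, CoopNMPC.Cfg (n i)) × (CoopNMPC.Six → ℝ) |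
      S.CollisionFree y.1 y.2})
    -- terminal set and terminal cost
    (hEf_sub : D.terminal ⊆ D.errSet S) (hEf_closed : IsClosed D.terminal)
    (hEf_zero : (0 : CoopNMPC.State n) ∈ D.terminal)
    (hterm : D.TerminalCondition S)
    -- initial feasibility
    (e₀ : CoopNMPC.State n) (hfeas : D.Feasible S e₀)
    -- closed loop
    (e : ℝ → CoopNMPC.State n) (u : ℝ → CoopNMPC.Input N) (hcl : D.IsClosedLoop S e₀ e u) :
    Filter.Tendsto e Filter.atTop (nhds 0) ∧
    (∀ t, 0 ≤ t → e t ∈ D.errSet S ∧ u t ∈ D.errInputSet S (e t)) ∧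
    (∀ j : ℕ, D.Feasible S (e (j * D.hs))) := by
  have hmem := hcl.mem hhs hTp hEf_sub hterm hfeas
  refine ⟨?_, hmem, hcl.feasible hhs hTp hEf_sub hterm hfeas⟩
  obtain ⟨c, hc, hint⟩ :=
    hcl.exists_integral_sq_le hhs hTp hEf_sub hterm hfeas hQdiag hQ hR hP
  have hdiv : ∀ k, 0 < D.Q k k → ∃ c : ℕ → ℝ, Filter.Tendsto c Filter.atTop (nhds 0) ∧
      ∀ j : ℕ, ∫ s in (0 : ℝ)..D.hs, e (s + j * D.hs) k ^ 2 ≤ c j := fun k hk => by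
    refine ⟨fun j => c j / D.Q k k, by simpa using hc.div_const (D.Q k k), fun j => ?_⟩
    rw [le_div_iff₀' hk]
    exact hint j k
  -- Zero error lies in the terminal set, hence satisfies the state constraints, so the target is
  -- nonsingular.
  have htarget : D.target ∈ S.regular :=
    S.stateSet_subset_regular (by simpa [CoopNMPC.MPCData.errSet] using hEf_sub hEf_zero)
  exact CoopNMPC.MPCData.tendsto_zero_of_integral hN hhs (fun a b ha => hcl.isSolution hhs ha) hmem
    htarget (fun k => hdiv _ (hQpose k)) fun a => hdiv _ (hQjoint a)
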